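/- For $p\in[1,\infty)$ call a metric space $(X,\rho)$ a $p$-metric space if $\rho(x,z)^p\le\rho(x,y)^p+\rho(y,z)^p$ for all $x,y,z\in X$, and call an infinite real matrix $r=(r_{i,j})_{i,j\ge 1}$ a $p$-distance matrix if $r_{i,i}=0$, $r_{i,j}=r_{j,i}\ge 0$ and $r_{i,j}^p\le r_{i,k}^p+r_{k,j}^p$ for all $i,j,k$ (and similarly for finite matrices). A vector $a\in\mathbb R^n$ is admissible for a $p$-distance matrix $q$ of order $n$ if attaching $a$ to $q$ as last row and column, with $0$ on the diagonal, gives a $p$-distance matrix of order $n+1$. A $p$-distance matrix $r$ is universal if for all $\epsilon>0$, all $n$ and every vector $a$ admissible for $(r_{i,j})_{i,j\le n}$ there is $m$ with $\max_{i\le n}|r_{i,m}-a_i|<\epsilon$. Polish means complete separable metric. For a Borel probability measure $\gamma$ on $[0,\infty)$ without atoms and of full support, the random $p$-metric on $\mathbb N$ is given by a probability measure $\nu$ on the set of $p$-distance matrices such that for each $n\ge 2$: the entry $r_{1,n}$ has law $\gamma$ and is independent of $(r_{i,j})_{i,j\le n-1}$; and for $1\le k<n-1$ the conditional distribution of $r_{k+1,n}$,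 given $(r_{i,j})_{i,j\le n-1}$ and $r_{1,n},\dots,r_{k,n}$, is the uniform distribution on the segment of possible values $$\Big[\max_{i\le k}|r_{i,k+1}^p-r_{i,n}^p|^{1/p},\ \min_{i\le k}(r_{i,k+1}^p+r_{i,n}^p)^{1/p}\Big]$$ (the point mass if the segment is a point). 1) For every $p\in[1,\infty)$ there is a Polish $p$-metric space $U_p$ such that every Polish $p$-metric space embeds isometrically into $U_p$, and every isometry between finite subsets of $U_p$ extends to an isometry of $U_p$ onto itself; any Polish $p$-metric space with these two properties is isometric to $U_p$. Moreover, for every $\gamma$ as above such a measure $\nu$ exists, and for every such $\nu$, $\nu$-almost every matrix $r$ is a universal $p$-distance matrix without zeros off the diagonal, and the completion of $(\mathbb N,r)$ is isometric to $U_p$. 2) There is no Polish ultrametric space into which every Polish ultrametric space embeds isometrically. -/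

import Mathlib

open MeasureTheory Set TopologicalSpace
open scoped NNReal ENNReal

universe u v

/-- The strengthened triangle inequality `r(x,y)^p + r(y,z)^p ≥ r(x,z)^p` on a metric space. -/
def IsPMetricSpace (p : ℝ) (X : Type u) [MetricSpace X] : Prop :=
  ∀ x y z : X, dist x z ^ p ≤ dist x y ^ p + dist y z ^ p

/-- Every Polish (complete separable) `p`-metric space embeds isometrically into `U`. -/
def EmbedsPolishPMetricSpaces (p : ℝ) (U : Type v) [MetricSpace U] : Prop :=
  ∀ (X : Type u) [MetricSpace X] [CompleteSpace X] [SeparableSpace X],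
    IsPMetricSpace p X → ∃ f : X → U, Isometry f

/-- Any isometry between two finite subsets of `U` extends to an isometry of `U` onto itself. -/
def IsFinitelyHomogeneous (U : Type u) [MetricSpace U] : Prop :=
  ∀ (n : ℕ) (a b : Fin n → U), (∀ i j, dist (a i) (a j) = dist (b i) (b j)) →
    ∃ J : U ≃ᵢ U, ∀ i, J (a i) = b i

/-- `p`-distance matrices with rows and columns indexed by `ι`; zeros off the diagonal
are allowed. -/
structure IsPDistanceMatrix (p : ℝ) {ι : Type*} (r : ι → ι → ℝ) : Prop where
  diag : ∀ i, r i i = 0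
  nonneg : ∀ i j, 0 ≤ r i j
  symm : ∀ i j, r i j = r j i
  triangle : ∀ i j k, r i j ^ p ≤ r i k ^ p + r k j ^ p

/-- A matrix is proper if it has no zeros outside the main diagonal. -/
def IsProperMatrix {ι : Type*} (r : ι → ι → ℝ) : Prop :=
  ∀ i j, i ≠ j → r i j ≠ 0

/-- The matrix `r^a`: the vector `a` is attached to `r` as a last row and column (indexed by
`none`), with `0` on the diagonal. -/
def attachVector {ι : Type*} (r : ι → ι → ℝ) (a : ι → ℝ) : Option ι → Option ι → ℝ
  | some i, some j => r i j
  | some i, none => a i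
  | none, some j => a j
  | none, none => 0

/-- The vector `a` is admissible for `r`: attaching it gives again a `p`-distance matrix. -/
def IsAdmissibleVector (p : ℝ) {ι : Type*} (r : ι → ι → ℝ) (a : ι → ℝ) : Prop :=
  IsPDistanceMatrix p (attachVector r a)

/-- The NW-corner of order `n` of an infinite matrix. -/
def nwCorner (n : ℕ) (r : ℕ → ℕ → ℝ) : Fin n → Fin n → ℝ :=
  fun i j => r i j

/-- Universal `p`-distance matrices: for every `n`, each admissible vector of the NW-corner of
order `n` is approximated by the beginnings of the columns. -/
def IsUniversalPDistanceMatrix (p : ℝ) (r : ℕ → ℕ → ℝ) : Prop :=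
  IsPDistanceMatrix p r ∧
    ∀ ε : ℝ, 0 < ε → ∀ (n : ℕ) (a : Fin n → ℝ), IsAdmissibleVector p (nwCorner n r) a →
      ∃ m : ℕ, ∀ i : Fin n, |r i m - a i| < ε

/-- For `p ≥ 1` a `p`-distance matrix satisfies the ordinary triangle inequality. -/
theorem IsPDistanceMatrix.dist_triangle {p : ℝ} (hp : 1 ≤ p) {ι : Type*} {r : ι → ι → ℝ}
    (hr : IsPDistanceMatrix p r) (i j k : ι) : r i k ≤ r i j + r j k := by
  have hp0 : 0 < p := by linarith
  have h1 := hr.nonneg i j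
  have h2 := hr.nonneg j k
  have h := (hr.triangle i k j).trans (Real.add_rpow_le_rpow_add h1 h2 hp)
  exact (Real.rpow_le_rpow_iff (hr.nonneg i k) (add_nonneg h1 h2) hp0).1 h

/-- The index set `ℕ` of an infinite `p`-distance matrix, as a type of its own so that it can
carry the (semi)metric given by the matrix. -/
structure MatrixSpace {p : ℝ} (hp : 1 ≤ p) {r : ℕ → ℕ → ℝ} (hr : IsPDistanceMatrix p r) where
  idx : ℕ

/-- The (semi)metric `ρ(i,j) = r i j`. -/
noncomputable instance {p : ℝ} (hp : 1 ≤ p) {r : ℕ → ℕ → ℝ} (hr : IsPDistanceMatrix p r) :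
    PseudoMetricSpace (MatrixSpace hp hr) where
  dist x y := r x.idx y.idx
  dist_self x := hr.diag x.idx
  dist_comm x y := hr.symm x.idx y.idx
  dist_triangle x y z := hr.dist_triangle hp x.idx y.idx z.idx

/-- The Polish space determined by the matrix: the (Hausdorff) completion of `(ℕ, r)`. -/
abbrev MatrixCompletion {p : ℝ} (hp : 1 ≤ p) {r : ℕ → ℕ → ℝ} (hr : IsPDistanceMatrix p r) :
    Type :=
  UniformSpace.Completion (MatrixSpace hp hr)

/-- Normalized Lebesgue measure on the segment `[a, b]` (the point mass if `a = b`). -/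
noncomputable def uniformOnSegment (a b : ℝ) : Measure ℝ :=
  open scoped Classical in
  if a < b then (volume (Icc a b))⁻¹ • volume.restrict (Icc a b) else Measure.dirac a

/-- Least value of the distance between the points `k` and `n` that is compatible with the
distances from both of them to the points `0, …, k - 1`. -/
noncomputable def leastDistance (p : ℝ) (r : ℕ → ℕ → ℝ) (n k : ℕ) : ℝ :=
  ⨆ i : Fin k, |r i k ^ p - r i n ^ p| ^ (1 / p)

/-- Greatest value of the distance between the points `k` and `n` that is compatible with the
distances from both of them to the points `0, …, k - 1`. -/
noncomputable def greatestDistance (p : ℝ) (r : ℕ → ℕ → ℝ) (n k : ℕ) : ℝ :=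
  ⨅ i : Fin k, (r i k ^ p + r i n ^ p) ^ (1 / p)

/-- The prescribed distribution of `r k n`, `k < n`, when the distances between the points
`0, …, n - 1` and the distances from `n` to `0, …, k - 1` are already known: `γ` for the first
row, and the uniform distribution on the segment of possible values for the other rows. -/
noncomputable def nextEntryLaw (p : ℝ) (γ : Measure ℝ≥0) (r : ℕ → ℕ → ℝ) (n k : ℕ) :
    Measure ℝ :=
  if k = 0 then γ.map (fun t : ℝ≥0 => (t : ℝ))
  else uniformOnSegment (leastDistance p r n k) (greatestDistance p r n k)

/-- The `σ`-algebra generated by the entries `r i j` with `i, j < n` and the entries `r i n`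
with `i < k`. -/
@[reducible]
def fragmentAlgebra (n k : ℕ) : MeasurableSpace (ℕ → ℕ → ℝ) :=
  MeasurableSpace.comap
    (fun (r : ℕ → ℕ → ℝ) (e : {e : ℕ × ℕ // (e.1 < n ∧ e.2 < n) ∨ (e.1 < k ∧ e.2 = n)}) =>
      r e.1.1 e.1.2)
    MeasurableSpace.pi

/-- `ν` is the law of the random `p`-metric on `ℕ` with parameter `γ`: a probability measure on
the cone of `p`-distance matrices for which `nextEntryLaw p γ r n k` is the conditional
distribution of the entry `r k n` given the entries determined before it. -/
structure IsRandomPMetricLaw (p : ℝ) (γ : Measure ℝ≥0) (ν : Measure (ℕ → ℕ → ℝ)) : Prop where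
  isProbabilityMeasure : IsProbabilityMeasure ν
  ae_isPDistanceMatrix : ∀ᵐ r ∂ν, IsPDistanceMatrix p r
  conditional_law : ∀ n k : ℕ, k < n →
    ∀ B : Set (ℕ → ℕ → ℝ), MeasurableSet[fragmentAlgebra n k] B →
    ∀ C : Set ℝ, MeasurableSet C →
      ν (B ∩ {r | r k n ∈ C}) = ∫⁻ r in B, nextEntryLaw p γ r n k C ∂ν

/-! Passing to `p`-th powers reduces the first part to the classical Urysohn setting: `D = r ^ p`
obeys the ordinary triangle inequality, and a nonnegative vector `a` is admissible exactly when `a ^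
p` is a Katětov function, `|a i ^ p - a j ^ p| ≤ D i j ≤ a i ^ p + a j ^ p`. Such functions are
produced from upper bounds `c` at finitely many points by `h x = min_i (c i + D x (y i))`
(`exists_minExtension`).

The pivot is `FiniteExtension`. For Polish `p`-metric spaces it gives, by back-and-forth,
universality, homogeneity and uniqueness up to isometry. Conversely, universality and homogeneity
imply it: embed the one-point extension abstractly, then move its base onto the given points. The
completion of a universal matrix has it, because an approximate realization of a Katětov function
can be improved by a small move (`IsUniversalPDistanceMatrix.exists_approx`), and the moves are
summable.

Universal matrices come from the random metric. The probability that a new column begins in a given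
open set depends only on a fixed corner, and it is positive once the set contains an admissible
vector (`columnProb_pos`). As it does not decay from column to column, the set is almost surely
visited (`IsRandomPMetricLaw.ae_exists_column_mem`); countably many rational balls then suffice. The
law itself is the image of a product measure of independent inputs, one for each entry.

In the ultrametric case a separable space has only countably many distances, while two-point spaces
need uncountably many. -/

/-! ### Isometric relations, the extension property and back-and-forth -/

/-- A relation between two metric spaces that preserves distances. -/
def IsIsometricRel {X Y : Type*} [Dist X] [Dist Y] (R : Set (X × Y)) : Prop :=
  ∀ a ∈ R, ∀ b ∈ R, dist a.1 b.1 = dist a.2 b.2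

theorem isIsometricRel_closure {X Y : Type*} [MetricSpace X] [MetricSpace Y] {R : Set (X × Y)}
    (hR : IsIsometricRel R) : IsIsometricRel (closure R) := by
  have h1 : IsClosed {q : (X × Y) × (X × Y) | dist q.1.1 q.2.1 = dist q.1.2 q.2.2} :=
    isClosed_eq (by fun_prop) (by fun_prop)
  have h2 : closure (R ×ˢ R) ⊆ {q : (X × Y) × (X × Y) | dist q.1.1 q.2.1 = dist q.1.2 q.2.2} :=
    closure_minimal (fun q hq => hR _ hq.1 _ hq.2) h1
  intro a ha b hb
  rw [closure_prod_eq] at h2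
  exact h2 (show (a, b) ∈ _ from ⟨ha, hb⟩)

/-- If first coordinates of pairs in `R` converge, the second coordinates form a Cauchy sequence, so
by completeness every point is a first coordinate in `closure R`. That closure is still isometric,
hence it is the graph of an isometry. -/
theorem IsIsometricRel.exists_isometry {X Y : Type*} [MetricSpace X] [MetricSpace Y]
    [CompleteSpace Y] {R : Set (X × Y)} (hR : IsIsometricRel R) (hd : Dense (Prod.fst '' R)) :
    ∃ f : X → Y, Isometry f ∧ ∀ a ∈ R, f a.1 = a.2 := by
  have key : ∀ x, ∃ y, (x, y) ∈ closure R := by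
    intro x
    obtain ⟨s, hs, hsx⟩ := mem_closure_iff_seq_limit.1 (hd x)
    choose t ht hts using hs
    have hc : CauchySeq (fun n => (t n).2) := by
      have := hsx.cauchySeq
      rw [Metric.cauchySeq_iff] at this ⊢
      intro ε hε
      obtain ⟨N, hN⟩ := this ε hε
      refine ⟨N, fun m hm n hn => ?_⟩
      rw [← hR _ (ht m) _ (ht n), hts, hts]
      exact hN m hm n hn
    obtain ⟨y, hy⟩ := cauchySeq_tendsto_of_complete hc
    refine ⟨y, mem_closure_iff_seq_limit.2 ⟨t, ht, ?_⟩⟩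
    rw [Prod.tendsto_iff]
    exact ⟨by simpa only [hts] using hsx, hy⟩
  choose f hf using key
  refine ⟨f, Isometry.of_dist_eq fun x x' => ((isIsometricRel_closure hR) _ (hf x) _ (hf x')).symm, ?_⟩
  intro a ha
  have := (isIsometricRel_closure hR) _ (hf a.1) _ (subset_closure ha)
  rw [dist_self] at this
  exact dist_eq_zero.1 this.symm

theorem IsIsometricRel.exists_isometryEquiv {X Y : Type*} [MetricSpace X] [MetricSpace Y]
    [CompleteSpace X] [CompleteSpace Y] {R : Set (X × Y)} (hR : IsIsometricRel R)
    (hd : Dense (Prod.fst '' R)) (hd' : Dense (Prod.snd '' R)) :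
    ∃ J : X ≃ᵢ Y, ∀ a ∈ R, J a.1 = a.2 := by
  obtain ⟨f, hf, hfR⟩ := hR.exists_isometry hd
  have hs : Function.Surjective f := by
    have h1 : Prod.snd '' R ⊆ range f := by
      rintro _ ⟨a, ha, rfl⟩
      exact ⟨a.1, hfR a ha⟩
    -- Completeness of `X` makes the range closed; it contains a dense set.
    have h2 : IsClosed (range f) := hf.isClosedEmbedding.isClosed_range
    rw [← range_eq_univ, ← h2.closure_eq]
    exact (hd'.mono h1).closure_eq
  exact ⟨IsometryEquiv.mk (Equiv.ofBijective f ⟨hf.injective, hs⟩) hf, hfR⟩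

/-- Every admissible vector over a finite family of points is the vector of distances to some
point of the space. -/
def FiniteExtension (p : ℝ) (X : Type*) [MetricSpace X] : Prop :=
  ∀ (n : ℕ) (y : Fin n → X) (a : Fin n → ℝ),
    IsAdmissibleVector p (fun i j => dist (y i) (y j)) a → ∃ z, ∀ i, dist (y i) z = a i

theorem isPDistanceMatrix_dist {p : ℝ} {X : Type*} [MetricSpace X] (hX : IsPMetricSpace p X)
    {ι : Type*} (y : ι → X) : IsPDistanceMatrix p (fun i j => dist (y i) (y j)) where
  diag _ := dist_self _
  nonneg _ _ := dist_nonneg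
  symm _ _ := dist_comm _ _
  triangle _ _ _ := hX _ _ _

/-- The finite isometric relations, ordered by inclusion. -/
abbrev PartialIsometry (X Y : Type*) [Dist X] [Dist Y] :=
  {R : Finset (X × Y) // IsIsometricRel (R : Set (X × Y))}

theorem IsIsometricRel.insert {X Y : Type*} [MetricSpace X] [MetricSpace Y] {R : Set (X × Y)}
    (hR : IsIsometricRel R) {c : X × Y} (hc : ∀ a ∈ R, dist a.1 c.1 = dist a.2 c.2) :
    IsIsometricRel (insert c R) := by
  rintro a (rfl | ha) b (rfl | hb)
  · simp
  · rw [dist_comm, hc b hb, dist_comm]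
  · exact hc a ha
  · exact hR a ha b hb

/-- The distances from `x` to the first coordinates form an admissible vector over the second
coordinates, since `R` identifies the two finite metrics. -/
theorem IsIsometricRel.exists_extend {p : ℝ} {X Y : Type*} [MetricSpace X] [MetricSpace Y]
    (hX : IsPMetricSpace p X) (hY : FiniteExtension p Y) {R : Finset (X × Y)}
    (hR : IsIsometricRel (R : Set (X × Y))) (x : X) :
    ∃ y, ∀ a ∈ R, dist a.1 x = dist a.2 y := by
  let e := R.equivFin
  obtain ⟨z, hz⟩ := hY R.card (fun i => (e.symm i).1.2) (fun i => dist (e.symm i).1.1 x) (by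
    have := isPDistanceMatrix_dist hX
      (fun o : Option (Fin R.card) => o.elim x (fun i => (e.symm i).1.1))
    unfold IsAdmissibleVector
    convert this using 3 with i j
    cases i <;> cases j
    · simp [attachVector]
    · simp [attachVector, dist_comm]
    · simp [attachVector]
    · simp only [attachVector, Option.elim]
      exact (hR _ (e.symm _).2 _ (e.symm _).2).symm)
  refine ⟨z, fun a ha => ?_⟩
  have := hz (e ⟨a, ha⟩)
  simpa using this.symm

/-- The finite partial isometries that are defined at `x`. -/
def PartialIsometry.definedAt {p : ℝ} {X Y : Type*} [MetricSpace X] [MetricSpace Y]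
    (hX : IsPMetricSpace p X) (hY : FiniteExtension p Y) (x : X) :
    Order.Cofinal (PartialIsometry X Y) where
  carrier := {R | ∃ y, (x, y) ∈ R.1}
  isCofinal := by
    classical
    intro R
    obtain ⟨y, hy⟩ := R.2.exists_extend hX hY x
    refine ⟨⟨insert (x, y) R.1, ?_⟩, ⟨y, by simp⟩, ?_⟩
    · rw [Finset.coe_insert]
      exact R.2.insert hy
    · exact Finset.subset_insert _ _

theorem IsIsometricRel.swap {X Y : Type*} [MetricSpace X] [MetricSpace Y] {R : Set (X × Y)}
    (hR : IsIsometricRel R) : IsIsometricRel (Prod.swap '' R) := by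
  rintro _ ⟨a, ha, rfl⟩ _ ⟨b, hb, rfl⟩
  exact (hR a ha b hb).symm

/-- The finite partial isometries with `y` in their range. -/
def PartialIsometry.attains {p : ℝ} {X Y : Type*} [MetricSpace X] [MetricSpace Y]
    (hX : FiniteExtension p X) (hY : IsPMetricSpace p Y) (y : Y) :
    Order.Cofinal (PartialIsometry X Y) where
  carrier := {R | ∃ x, (x, y) ∈ R.1}
  isCofinal := by
    classical
    intro R
    have h : IsIsometricRel ((R.1.image Prod.swap : Finset (Y × X)) : Set (Y × X)) := by
      rw [Finset.coe_image]
      exact R.2.swap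
    obtain ⟨x, hx⟩ := h.exists_extend hY hX y
    refine ⟨⟨insert (x, y) R.1, ?_⟩, ⟨x, by simp⟩, ?_⟩
    · rw [Finset.coe_insert]
      refine R.2.insert fun a ha => ?_
      exact (hx a.swap (Finset.mem_image_of_mem _ ha)).symm
    · exact Finset.subset_insert _ _

/-- A countable family of cofinal sets of finite partial isometries is met by an isometric
relation that extends a given finite partial isometry. -/
theorem PartialIsometry.exists_generic {X Y ι : Type*} [MetricSpace X] [MetricSpace Y]
    [Countable ι] (R₀ : PartialIsometry X Y) (𝒟 : ι → Order.Cofinal (PartialIsometry X Y)) :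
    ∃ R : Set (X × Y), IsIsometricRel R ∧ ↑R₀.1 ⊆ R ∧ ∀ i, ∃ S ∈ 𝒟 i, ↑S.1 ⊆ R := by
  obtain ⟨_⟩ := nonempty_encodable ι
  -- The Rasiowa–Sikorski argument: an ideal through `R₀` meets every set of the family, and its
  -- union is isometric because any two members lie in a common one.
  let I := Order.idealOfCofinals R₀ 𝒟
  refine ⟨⋃ S ∈ I, ↑S.1, ?_, ?_, fun i => ?_⟩
  · intro a ha b hb
    simp only [mem_iUnion] at ha hb
    obtain ⟨S, hS, ha⟩ := ha
    obtain ⟨T, hT, hb⟩ := hb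
    obtain ⟨W, -, hSW, hTW⟩ := I.directed S hS T hT
    exact W.2 a (hSW ha) b (hTW hb)
  · exact subset_biUnion_of_mem (u := fun S : PartialIsometry X Y => (S.1 : Set (X × Y)))
      (Order.mem_idealOfCofinals R₀ 𝒟)
  · obtain ⟨S, hS, hSI⟩ := Order.cofinal_meets_idealOfCofinals R₀ 𝒟 i
    exact ⟨S, hS, subset_biUnion_of_mem
      (u := fun S : PartialIsometry X Y => (S.1 : Set (X × Y))) hSI⟩

theorem FiniteExtension.exists_isometry {p : ℝ} {X Y : Type*} [MetricSpace X] [MetricSpace Y]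
    [SeparableSpace X] [CompleteSpace Y] (hX : IsPMetricSpace p X) (hY : FiniteExtension p Y) :
    ∃ f : X → Y, Isometry f := by
  obtain ⟨s, hs, hsd⟩ := exists_countable_dense X
  have := hs.to_subtype
  obtain ⟨R, hR, -, h⟩ := PartialIsometry.exists_generic
    (⟨∅, by simp [IsIsometricRel]⟩ : PartialIsometry X Y)
    (fun x : s => PartialIsometry.definedAt hX hY x.1)
  obtain ⟨f, hf, -⟩ := hR.exists_isometry (hsd.mono fun x hx => by
    obtain ⟨S, ⟨y, hy⟩, hS⟩ := h ⟨x, hx⟩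
    exact ⟨(x, y), hS hy, rfl⟩)
  exact ⟨f, hf⟩

theorem FiniteExtension.exists_isometryEquiv {p : ℝ} {X Y : Type*} [MetricSpace X]
    [MetricSpace Y] [SeparableSpace X] [SeparableSpace Y] [CompleteSpace X] [CompleteSpace Y]
    (hX : IsPMetricSpace p X) (hX' : FiniteExtension p X) (hY : IsPMetricSpace p Y)
    (hY' : FiniteExtension p Y) {n : ℕ} (a : Fin n → X) (b : Fin n → Y)
    (hab : ∀ i j, dist (a i) (a j) = dist (b i) (b j)) :
    ∃ J : X ≃ᵢ Y, ∀ i, J (a i) = b i := by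
  classical
  obtain ⟨s, hs, hsd⟩ := exists_countable_dense X
  obtain ⟨t, ht, htd⟩ := exists_countable_dense Y
  have := hs.to_subtype
  have := ht.to_subtype
  obtain ⟨R, hR, h0, h⟩ := PartialIsometry.exists_generic
    (⟨Finset.univ.image fun i => (a i, b i), by
      simp only [Finset.coe_image, Finset.coe_univ, image_univ]
      rintro _ ⟨i, rfl⟩ _ ⟨j, rfl⟩
      exact hab i j⟩ : PartialIsometry X Y)
    (Sum.elim (fun x : s => PartialIsometry.definedAt hX hY' x.1)
      (fun y : t => PartialIsometry.attains hX' hY y.1))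
  obtain ⟨J, hJ⟩ := hR.exists_isometryEquiv
    (hsd.mono fun x hx => by
      obtain ⟨S, ⟨y, hy⟩, hS⟩ := h (Sum.inl ⟨x, hx⟩)
      exact ⟨(x, y), hS hy, rfl⟩)
    (htd.mono fun y hy => by
      obtain ⟨S, ⟨x, hx⟩, hS⟩ := h (Sum.inr ⟨y, hy⟩)
      exact ⟨(x, y), hS hx, rfl⟩)
  exact ⟨J, fun i => hJ (a i, b i) (h0 (Finset.mem_coe.2
    (Finset.mem_image_of_mem _ (Finset.mem_univ i))))⟩

/-! ### Universality and homogeneity imply the extension property -/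

/-- The index set of a `p`-distance matrix with the semimetric given by the matrix. -/
@[reducible]
def IsPDistanceMatrix.pseudoMetricSpace {p : ℝ} (hp : 1 ≤ p) {ι : Type*} {r : ι → ι → ℝ}
    (hr : IsPDistanceMatrix p r) : PseudoMetricSpace ι where
  dist := r
  dist_self := hr.diag
  dist_comm := hr.symm
  dist_triangle := hr.dist_triangle hp

theorem IsFinitelyHomogeneous.finiteExtension {p : ℝ} (hp : 1 ≤ p) {V : Type v} [MetricSpace V]
    (hV : IsFinitelyHomogeneous V) (hV' : EmbedsPolishPMetricSpaces.{u} p V) :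
    FiniteExtension p V := by
  intro n y a ha
  have hq : IsPDistanceMatrix p (fun i j : ULift.{u} (Option (Fin n)) =>
      attachVector (fun i j => dist (y i) (y j)) a i.down j.down) :=
    ⟨fun i => ha.diag _, fun i j => ha.nonneg _ _, fun i j => ha.symm _ _,
      fun i j k => ha.triangle _ _ _⟩
  let _ := hq.pseudoMetricSpace hp
  -- The vector may have zeros and the points `y i` may repeat, so the one-point extension is only a
  -- semimetric space. Its quotient is finite, hence Polish, and embeds into `V`; homogeneity then
  -- carries the copies of the `y i` to the `y i` themselves.
  have : Finite (SeparationQuotient (ULift.{u} (Option (Fin n)))) :=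
    Finite.of_surjective _ SeparationQuotient.surjective_mk
  obtain ⟨f, hf⟩ := hV' (SeparationQuotient (ULift.{u} (Option (Fin n)))) (by
    intro x z w
    obtain ⟨x, rfl⟩ := SeparationQuotient.surjective_mk x
    obtain ⟨z, rfl⟩ := SeparationQuotient.surjective_mk z
    obtain ⟨w, rfl⟩ := SeparationQuotient.surjective_mk w
    exact hq.triangle _ _ _)
  let g : Option (Fin n) → V := fun o => f (SeparationQuotient.mk (ULift.up o))
  have hg : ∀ i j, dist (g i) (g j) = attachVector (fun i j => dist (y i) (y j)) a i j := by
    intro i j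
    exact hf.dist_eq _ _
  obtain ⟨J, hJ⟩ := hV n (fun i => g (some i)) y (fun i j => hg _ _)
  refine ⟨J (g none), fun i => ?_⟩
  rw [← hJ, J.dist_eq, hg]
  rfl

/-! ### Ultrametric spaces -/

/-- Moving an endpoint by less than `dist x y` leaves the distance unchanged, so every nonzero
distance already occurs within a countable dense set. -/
theorem countable_range_dist_of_isUltrametricDist (X : Type*) [MetricSpace X] [SeparableSpace X]
    [IsUltrametricDist X] : (range fun q : X × X => dist q.1 q.2).Countable := by
  obtain ⟨s, hs, hsd⟩ := exists_countable_dense X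
  refine (((hs.prod hs).image fun q : X × X => dist q.1 q.2).union (countable_singleton 0)).mono ?_
  rintro _ ⟨⟨x, y⟩, rfl⟩
  rcases eq_or_ne x y with rfl | hxy
  · right; simp
  have h0 : 0 < dist x y := dist_pos.2 hxy
  obtain ⟨x', hx', h1⟩ := hsd.exists_dist_lt x h0
  obtain ⟨y', hy', h2⟩ := hsd.exists_dist_lt y h0
  left
  refine ⟨(x', y'), ⟨hx', hy'⟩, ?_⟩
  have e1 : dist x' y = dist x y := by
    have a1 := dist_triangle_max x' x y
    have a2 := dist_triangle_max x x' y
    rw [dist_comm x' x, max_eq_right h1.le] at a1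
    rcases le_max_iff.1 a2 with h | h
    · exact absurd h (not_le.2 h1)
    · exact le_antisymm a1 h
  have e2 : dist x' y' = dist x' y := by
    rw [← e1] at h2
    have a1 := dist_triangle_max x' y y'
    have a2 := dist_triangle_max x' y' y
    rw [max_eq_left h2.le] at a1
    rw [dist_comm y' y] at a2
    rcases le_max_iff.1 a2 with h | h
    · exact le_antisymm a1 h
    · exact absurd h (not_le.2 h2)
  exact e2.trans e1

/-- The two-point space with distance `t`. -/
@[reducible]
def twoPointSpace {t : ℝ} (ht : 0 < t) : MetricSpace (ULift.{u} Bool) where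
  dist x y := if x = y then 0 else t
  dist_self x := by simp
  dist_comm x y := by simp only [eq_comm]
  dist_triangle x y z := by
    split_ifs <;> simp_all <;> linarith
  eq_of_dist_eq_zero {x y} h := by
    by_contra hxy
    simp only [if_neg hxy] at h
    exact ht.ne' h

theorem not_exists_universal_ultrametric :
    ¬ ∃ (U : Type v) (_ : MetricSpace U) (_ : CompleteSpace U) (_ : SeparableSpace U),
        IsUltrametricDist U ∧
        ∀ (X : Type u) [MetricSpace X] [CompleteSpace X] [SeparableSpace X]
          [IsUltrametricDist X], ∃ f : X → U, Isometry f := by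
  rintro ⟨U, _, _, _, _, h⟩
  have hsub : Ioi (0 : ℝ) ⊆ range fun q : U × U => dist q.1 q.2 := by
    intro t ht
    let _ := twoPointSpace.{u} (t := t) ht
    have : IsUltrametricDist (ULift.{u} Bool) := ⟨fun x y z => by
      have ht' : (0 : ℝ) < t := ht
      change (if x = z then 0 else t) ≤ max (if x = y then 0 else t) (if y = z then 0 else t)
      split_ifs <;> simp_all [le_of_lt]⟩
    obtain ⟨f, hf⟩ := h (ULift.{u} Bool)
    refine ⟨(f ⟨true⟩, f ⟨false⟩), ?_⟩
    change dist (f ⟨true⟩) (f ⟨false⟩) = t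
    rw [hf.dist_eq]
    change (if (⟨true⟩ : ULift.{u} Bool) = ⟨false⟩ then 0 else t) = t
    simp
  have h1 := (countable_range_dist_of_isUltrametricDist U).mono hsub
  have h2 := h1.measure_zero volume
  simp at h2

/-! ### Katětov functions, and the extension property from universal sequences -/

theorem isAdmissibleVector_iff {p : ℝ} (hp : 0 < p) {ι : Type*} {r : ι → ι → ℝ}
    (hr : IsPDistanceMatrix p r) {a : ι → ℝ} :
    IsAdmissibleVector p r a ↔ (∀ i, 0 ≤ a i) ∧ (∀ i j, r i j ^ p ≤ a i ^ p + a j ^ p) ∧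
      ∀ i j, a i ^ p ≤ a j ^ p + r i j ^ p := by
  constructor
  · intro h
    refine ⟨fun i => h.nonneg (some i) none, fun i j => h.triangle (some i) (some j) none,
      fun i j => ?_⟩
    rw [add_comm]
    exact h.triangle (some i) none (some j)
  · rintro ⟨h1, h2, h3⟩
    refine ⟨?_, ?_, ?_, ?_⟩
    · rintro (_ | i)
      exacts [rfl, hr.diag i]
    · rintro (_ | i) (_ | j)
      exacts [le_rfl, h1 j, h1 i, hr.nonneg i j]
    · rintro (_ | i) (_ | j)
      exacts [rfl, rfl, rfl, hr.symm i j]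
    · have h0 : (0 : ℝ) ^ p = 0 := Real.zero_rpow hp.ne'
      rintro (_ | i) (_ | j) (_ | k)
      · simp [attachVector, h0]
      · have := Real.rpow_nonneg (h1 k) p
        simp only [attachVector, h0]
        linarith
      · simp [attachVector, h0]
      · simp only [attachVector]
        rw [hr.symm k j]
        exact h3 j k
      · simp [attachVector, h0]
      · simp only [attachVector]
        rw [add_comm]
        exact h3 i k
      · exact h2 i j
      · exact hr.triangle i j k

/-- Prescribed upper bounds `c` at finitely many points determine a Katětov function, the
greatest one that obeys the bounds. -/
theorem exists_minExtension {α ι : Type*} [Finite ι] [Nonempty ι] {D : α → α → ℝ}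
    (hs : ∀ x y, D x y = D y x) (ht : ∀ x y z, D x z ≤ D x y + D y z) (y : ι → α) (c : ι → ℝ)
    (hc : ∀ i j, D (y i) (y j) ≤ c i + c j) :
    ∃ h : α → ℝ, (∀ x x', D x x' ≤ h x + h x') ∧ (∀ x x', h x ≤ h x' + D x x') ∧
      (∀ i x, h x ≤ c i + D x (y i)) ∧ ∀ x, ∃ i, h x = c i + D x (y i) := by
  have hle : ∀ i x, ⨅ i, (c i + D x (y i)) ≤ c i + D x (y i) := fun i x =>
    ciInf_le (Set.finite_range _).bddBelow i
  have hex : ∀ x, ∃ i, ⨅ i, (c i + D x (y i)) = c i + D x (y i) := fun x => by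
    obtain ⟨i, hi⟩ := exists_eq_ciInf_of_finite (f := fun i => c i + D x (y i))
    exact ⟨i, hi.symm⟩
  refine ⟨fun x => ⨅ i, (c i + D x (y i)), fun x x' => ?_, fun x x' => ?_, hle, hex⟩
  · obtain ⟨i, hi⟩ := hex x
    obtain ⟨j, hj⟩ := hex x'
    have h1 := ht x (y i) x'
    have h2 := ht (y i) (y j) x'
    have h3 := hc i j
    have h4 := hs x' (y j)
    dsimp only
    linarith
  · obtain ⟨j, hj⟩ := hex x'
    have h1 := hle j x
    have h2 := ht x x' (y j)
    dsimp only
    linarith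

theorem isAdmissibleVector_rpow_inv {p : ℝ} (hp : 0 < p) {ι : Type*} {r : ι → ι → ℝ}
    (hr : IsPDistanceMatrix p r) {h : ι → ℝ} (h1 : ∀ i j, r i j ^ p ≤ h i + h j)
    (h2 : ∀ i j, h i ≤ h j + r i j ^ p) :
    (∀ i, (h i ^ p⁻¹) ^ p = h i) ∧ IsAdmissibleVector p r (fun i => h i ^ p⁻¹) := by
  have h0 : ∀ i, 0 ≤ h i := fun i => by
    have := h1 i i
    rw [hr.diag, Real.zero_rpow hp.ne'] at this
    linarith
  have e : ∀ i, (h i ^ p⁻¹) ^ p = h i := fun i => Real.rpow_inv_rpow (h0 i) hp.ne'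
  refine ⟨e, (isAdmissibleVector_iff hp hr).2 ⟨fun i => Real.rpow_nonneg (h0 i) _, ?_, ?_⟩⟩
  · intro i j
    rw [e, e]
    exact h1 i j
  · intro i j
    rw [e, e]
    exact h2 i j

/-- In a space with a universal dense sequence, a point whose distances to a finite family are
nearly the prescribed ones can be moved slightly to improve the approximation. -/
theorem IsUniversalPDistanceMatrix.exists_approx {p : ℝ} (hp : 0 < p) {X : Type*} [MetricSpace X]
    (hX : IsPMetricSpace p X) {x : ℕ → X} (hx : DenseRange x)
    (hu : IsUniversalPDistanceMatrix p (fun i j => dist (x i) (x j))) {n : ℕ} (y : Fin n → X)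
    (a : Fin n → ℝ) (h1 : ∀ i j, dist (y i) (y j) ^ p ≤ a i + a j)
    (h2 : ∀ i j, a i ≤ a j + dist (y i) (y j) ^ p) (z : X) {ε δ : ℝ} (hε : 0 ≤ ε)
    (hz : ∀ i, |dist (y i) z ^ p - a i| ≤ ε) (hδ : 0 < δ) :
    ∃ z', dist z z' ^ p ≤ ε + δ ∧ ∀ i, |dist (y i) z' ^ p - a i| ≤ δ := by
  have h0 : (0 : ℝ) ^ p = 0 := Real.zero_rpow hp.ne'
  -- The point `z` joins the family with the bound `ε`. By `hz` this bound is compatible with the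
  -- others and does not lower the values at the `y i`, so `h (y i) = a i` while `h z ≤ ε`. A point
  -- that nearly realizes `h` therefore has nearly the right distances and is close to `z`.
  let y' : Option (Fin n) → X := fun o => o.elim z y
  let c : Option (Fin n) → ℝ := fun o => o.elim ε a
  obtain ⟨h, k1, k2, k3, k4⟩ := exists_minExtension (D := fun s t : X => dist s t ^ p)
    (fun s t => by rw [dist_comm]) (fun s t w => hX s t w) y' c (by
      rintro (_ | i) (_ | j)
      · simp only [y', c, Option.elim, dist_self, h0]
        linarith
      · have := abs_le.1 (hz j)
        simp only [y', c, Option.elim]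
        rw [dist_comm]
        linarith
      · have := abs_le.1 (hz i)
        simp only [y', c, Option.elim]
        linarith
      · exact h1 i j)
  have hy : ∀ i, h (y i) = a i := by
    intro i
    refine le_antisymm ?_ ?_
    · have := k3 (some i) (y i)
      simpa [y', c, h0] using this
    · obtain ⟨j, hj⟩ := k4 (y i)
      rw [hj]
      cases j with
      | none =>
        have := abs_le.1 (hz i)
        simp only [y', c, Option.elim]
        linarith
      | some j => exact h2 i j
  have hzε : h z ≤ ε := by
    have := k3 none z
    simpa [y', c, h0] using this
  -- Universality speaks only of the points of the sequence, so each `y' o` is replaced by some `x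
  -- (m o)`. The replacement costs `δ / 3` in `h` and `δ / 3` in the distance power, and the
  -- realization a third `δ / 3`.
  have hm : ∀ o, ∃ m, dist (y' o) (x m) ^ p < δ / 3 := by
    intro o
    obtain ⟨m, hm⟩ := hx.exists_dist_lt (y' o) (ε := (δ / 3) ^ p⁻¹)
      (Real.rpow_pos_of_pos (by linarith) _)
    refine ⟨m, ?_⟩
    have := Real.rpow_lt_rpow dist_nonneg hm hp
    rwa [Real.rpow_inv_rpow (by linarith) hp.ne'] at this
  choose m hm using hm
  obtain ⟨N, hN⟩ := (Set.finite_range m).bddAbove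
  have hN' : ∀ o, m o < N + 1 := fun o => Nat.lt_succ_of_le (hN ⟨o, rfl⟩)
  have hr : IsPDistanceMatrix p (nwCorner (N + 1) fun i j => dist (x i) (x j)) :=
    isPDistanceMatrix_dist hX (fun i : Fin (N + 1) => x i)
  obtain ⟨e, hadm⟩ := isAdmissibleVector_rpow_inv hp hr
    (h := fun i => h (x i)) (fun i j => k1 _ _) (fun i j => k2 _ _)
  have hcont : Continuous fun (v : Fin (N + 1) → ℝ) i => v i ^ p :=
    continuous_pi fun i => (continuous_apply i).rpow_const fun _ => Or.inr hp.le
  obtain ⟨η, hη, hηd⟩ := Metric.continuous_iff.1 hcont (fun i => h (x i) ^ p⁻¹) (δ / 3)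
    (by linarith)
  obtain ⟨q, hq⟩ := hu.2 η hη (N + 1) _ hadm
  have hq' : ∀ i < N + 1, |dist (x i) (x q) ^ p - h (x i)| < δ / 3 := by
    intro i hi
    have h3 := hηd (fun i => dist (x i) (x q)) ((dist_pi_lt_iff hη).2 fun i => hq i)
    have h4 := (dist_pi_lt_iff (by linarith)).1 h3 ⟨i, hi⟩
    rw [Real.dist_eq] at h4
    have h5 := e ⟨i, hi⟩
    dsimp only at h4 h5
    rwa [h5] at h4
  have key : ∀ o, |dist (y' o) (x q) ^ p - h (y' o)| ≤ δ := by
    intro o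
    have b1 := abs_lt.1 (hq' _ (hN' o))
    have b2 := hm o
    have b3 := hX (y' o) (x (m o)) (x q)
    have b4 := hX (x (m o)) (y' o) (x q)
    have b5 := k2 (y' o) (x (m o))
    have b6 := k2 (x (m o)) (y' o)
    rw [dist_comm (x (m o)) (y' o)] at b4 b6
    rw [abs_le]
    constructor <;> linarith
  refine ⟨x q, ?_, fun i => ?_⟩
  · have := (abs_le.1 (key none)).2
    simp only [y', Option.elim] at this
    linarith
  · have := key (some i)
    simp only [y', Option.elim] at this
    rwa [hy] at this

theorem IsUniversalPDistanceMatrix.finiteExtension {p : ℝ} (hp : 0 < p) {X : Type*}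
    [MetricSpace X] [CompleteSpace X] (hX : IsPMetricSpace p X) {x : ℕ → X} (hx : DenseRange x)
    (hu : IsUniversalPDistanceMatrix p (fun i j => dist (x i) (x j))) : FiniteExtension p X := by
  intro n y b hb
  obtain ⟨hb0, hb1, hb2⟩ := (isAdmissibleVector_iff hp (isPDistanceMatrix_dist hX y)).1 hb
  -- The errors are chosen so that `e k + e (k + 1) ≤ 2 * e k = ((1 / 2) ^ k) ^ p`; the move at
  -- stage `k` then has length at most `(1 / 2) ^ k`, and the points form a Cauchy sequence.
  let e : ℕ → ℝ := fun k => ((1 / 2 : ℝ) ^ k) ^ p / 2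
  have he : ∀ k, 0 < e k := fun k => by positivity
  have hea : ∀ k, e (k + 1) ≤ e k := fun k => by
    have : ((1 / 2 : ℝ) ^ (k + 1)) ^ p ≤ ((1 / 2 : ℝ) ^ k) ^ p :=
      Real.rpow_le_rpow (by positivity)
        (pow_le_pow_of_le_one (by norm_num) (by norm_num) (Nat.le_succ k)) hp.le
    simp only [e]
    linarith
  let good : ℕ → X → Prop := fun k z => ∀ i, |dist (y i) z ^ p - b i ^ p| ≤ e k
  have start : ∃ z, good 0 z := by
    obtain ⟨z, -, hz⟩ := hu.exists_approx hp hX hx y (fun i => b i ^ p) hb1 hb2 (x 0)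
      -- At the start no approximation is needed: the sum of the errors at an arbitrary point is a
      -- valid, if crude, `ε`.
      (ε := ∑ i, |dist (y i) (x 0) ^ p - b i ^ p|) (Finset.sum_nonneg fun i _ => abs_nonneg _)
      (fun i => Finset.single_le_sum (f := fun i => |dist (y i) (x 0) ^ p - b i ^ p|)
        (fun i _ => abs_nonneg _) (Finset.mem_univ i)) (he 0)
    exact ⟨z, hz⟩
  have step : ∀ k z, good k z → ∃ z', good (k + 1) z' ∧ dist z z' ≤ 1 * (1 / 2 : ℝ) ^ k := by
    intro k z hz
    obtain ⟨z', h1, h2⟩ := hu.exists_approx hp hX hx y (fun i => b i ^ p) hb1 hb2 z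
      (he k).le hz (he (k + 1))
    refine ⟨z', h2, ?_⟩
    rw [one_mul, ← Real.rpow_le_rpow_iff dist_nonneg (by positivity) hp]
    refine h1.trans ?_
    have := hea k
    have h3 : ((1 / 2 : ℝ) ^ k) ^ p = 2 * e k := by simp only [e]; ring
    rw [h3]
    linarith
  choose! F hF hF' using step
  obtain ⟨z₀, hz₀⟩ := start
  let s : ℕ → X := fun k => Nat.rec z₀ (fun k z => F k z) k
  have hs : ∀ k, good k (s k) := by
    intro k
    induction k with
    | zero => exact hz₀
    | succ k ih => exact hF k _ ih
  have hc : CauchySeq s :=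
    cauchySeq_of_le_geometric (1 / 2) 1 (by norm_num) fun k => hF' k _ (hs k)
  obtain ⟨z, hz⟩ := cauchySeq_tendsto_of_complete hc
  refine ⟨z, fun i => ?_⟩
  have hlim : Filter.Tendsto (fun k => |dist (y i) (s k) ^ p - b i ^ p|) Filter.atTop
      (nhds |dist (y i) z ^ p - b i ^ p|) :=
    (((tendsto_const_nhds.dist hz).rpow_const (Or.inr hp.le)).sub_const _).abs
  have he0 : Filter.Tendsto e Filter.atTop (nhds 0) := by
    have h1 : Filter.Tendsto (fun k : ℕ => (1 / 2 : ℝ) ^ k) Filter.atTop (nhds 0) :=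
      tendsto_pow_atTop_nhds_zero_of_lt_one (by norm_num) (by norm_num)
    have h2 := (h1.rpow_const (p := p) (Or.inr hp.le)).div_const 2
    rwa [Real.zero_rpow hp.ne', zero_div] at h2
  have hle := le_of_tendsto_of_tendsto' hlim he0 fun k => hs k i
  have h3 : dist (y i) z ^ p = b i ^ p := sub_eq_zero.1 (abs_nonpos_iff.1 hle)
  exact (Real.rpow_left_inj dist_nonneg (hb0 i) hp.ne').1 h3

/-! ### The completion of a matrix -/

section MatrixCompletion

variable {p : ℝ} (hp : 1 ≤ p) {r : ℕ → ℕ → ℝ} (hr : IsPDistanceMatrix p r)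

/-- The sequence of points of the completion given by the indices of the matrix. -/
noncomputable def MatrixCompletion.point (i : ℕ) : MatrixCompletion hp hr :=
  ((⟨i⟩ : MatrixSpace hp hr) : UniformSpace.Completion (MatrixSpace hp hr))

theorem MatrixCompletion.dist_point (i j : ℕ) :
    dist (MatrixCompletion.point hp hr i) (MatrixCompletion.point hp hr j) = r i j :=
  UniformSpace.Completion.dist_eq _ _

theorem MatrixCompletion.denseRange_point : DenseRange (MatrixCompletion.point hp hr) :=
  UniformSpace.Completion.denseRange_coe.comp
    (Function.Surjective.denseRange fun x => ⟨x.idx, rfl⟩)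
    (UniformSpace.Completion.continuous_coe _)

theorem MatrixCompletion.separableSpace : SeparableSpace (MatrixCompletion hp hr) :=
  ⟨_, countable_range _, MatrixCompletion.denseRange_point hp hr⟩

theorem MatrixCompletion.isPMetricSpace : IsPMetricSpace p (MatrixCompletion hp hr) := by
  intro x y z
  have hp0 : 0 ≤ p := by linarith
  have hc : ∀ {f : MatrixCompletion hp hr × MatrixCompletion hp hr × MatrixCompletion hp hr → ℝ},
      Continuous f → Continuous fun q => f q ^ p := fun hf => hf.rpow_const fun _ => Or.inr hp0
  induction x, y, z using UniformSpace.Completion.induction_on₃ with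
  | hp => exact isClosed_le (hc (by fun_prop)) ((hc (by fun_prop)).add (hc (by fun_prop)))
  | ih x y z =>
    rw [UniformSpace.Completion.dist_eq, UniformSpace.Completion.dist_eq,
      UniformSpace.Completion.dist_eq]
    exact hr.triangle _ _ _

theorem MatrixCompletion.finiteExtension (hu : IsUniversalPDistanceMatrix p r) :
    FiniteExtension p (MatrixCompletion hp hr) := by
  refine IsUniversalPDistanceMatrix.finiteExtension (by linarith)
    (MatrixCompletion.isPMetricSpace hp hr) (MatrixCompletion.denseRange_point hp hr) ?_
  simpa only [MatrixCompletion.dist_point] using hu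

end MatrixCompletion

/-! ### Entries as functions of independent inputs -/

/-- The law of the input that determines an entry of the `k`-th row. -/
noncomputable def inputLaw (γ : Measure ℝ≥0) (k : ℕ) : Measure ℝ :=
  if k = 0 then γ.map (fun t : ℝ≥0 => (t : ℝ)) else volume.restrict (Icc 0 1)

/-- The range of the inputs for the entries of the `k`-th row. -/
def inputRange (k : ℕ) : Set ℝ :=
  if k = 0 then Ici 0 else Icc 0 1

/-- Lower end of the segment of possible distances to the point `k`, given the distances `v` to
the points before it. -/
noncomputable def lowerEnd (p : ℝ) (r : ℕ → ℕ → ℝ) (v : ℕ → ℝ) (k : ℕ) : ℝ :=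
  ⨆ i : Fin k, |r i k ^ p - v i ^ p| ^ (1 / p)

/-- Upper end of the segment of possible distances to the point `k`, given the distances `v` to
the points before it. -/
noncomputable def upperEnd (p : ℝ) (r : ℕ → ℕ → ℝ) (v : ℕ → ℝ) (k : ℕ) : ℝ :=
  ⨅ i : Fin k, (r i k ^ p + v i ^ p) ^ (1 / p)

/-- The `k`-th entry of a column, obtained from the entries `v` before it and an input `t`. -/
noncomputable def fillEntry (p : ℝ) (r : ℕ → ℕ → ℝ) (v : ℕ → ℝ) (k : ℕ) (t : ℝ) : ℝ :=
  if k = 0 then t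
  else lowerEnd p r v k + max (upperEnd p r v k - lowerEnd p r v k) 0 * t

instance (γ : Measure ℝ≥0) [IsProbabilityMeasure γ] (k : ℕ) :
    IsProbabilityMeasure (inputLaw γ k) := by
  unfold inputLaw
  split_ifs
  · exact Measure.isProbabilityMeasure_map (by fun_prop)
  · exact ⟨by simp⟩

theorem measurable_fillEntry (p : ℝ) (k : ℕ) : Measurable
    (fun q : ((ℕ → ℕ → ℝ) × (ℕ → ℝ)) × ℝ => fillEntry p q.1.1 q.1.2 k q.2) := by
  have hr : ∀ i j : ℕ, Measurable fun q : ((ℕ → ℕ → ℝ) × (ℕ → ℝ)) × ℝ => q.1.1 i j :=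
    fun i j => (measurable_pi_apply j).comp ((measurable_pi_apply i).comp
      (measurable_fst.comp measurable_fst))
  have hv : ∀ i : ℕ, Measurable fun q : ((ℕ → ℕ → ℝ) × (ℕ → ℝ)) × ℝ => q.1.2 i :=
    fun i => (measurable_pi_apply i).comp (measurable_snd.comp measurable_fst)
  have hl : Measurable fun q : ((ℕ → ℕ → ℝ) × (ℕ → ℝ)) × ℝ => lowerEnd p q.1.1 q.1.2 k :=
    Measurable.iSup fun i => (((hr i k).pow_const p).sub ((hv i).pow_const p)).abs.pow_const _
  have hu : Measurable fun q : ((ℕ → ℕ → ℝ) × (ℕ → ℝ)) × ℝ => upperEnd p q.1.1 q.1.2 k :=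
    Measurable.iInf fun i => (((hr i k).pow_const p).add ((hv i).pow_const p)).pow_const _
  unfold fillEntry
  split_ifs
  · exact measurable_snd
  · exact hl.add (((hu.sub hl).max measurable_const).mul measurable_snd)

theorem fillEntry_congr (p : ℝ) {r r' : ℕ → ℕ → ℝ} {v v' : ℕ → ℝ} {k : ℕ} (t : ℝ)
    (hr : ∀ i < k, r i k = r' i k) (hv : ∀ i < k, v i = v' i) :
    fillEntry p r v k t = fillEntry p r' v' k t := by
  have hl : lowerEnd p r v k = lowerEnd p r' v' k :=
    iSup_congr fun i => by rw [hr i i.2, hv i i.2]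
  have hu : upperEnd p r v k = upperEnd p r' v' k :=
    iInf_congr fun i => by rw [hr i i.2, hv i i.2]
  simp only [fillEntry, hl, hu]

theorem continuous_fillEntry (p : ℝ) (r : ℕ → ℕ → ℝ) (v : ℕ → ℝ) (k : ℕ) :
    Continuous (fillEntry p r v k) := by
  unfold fillEntry
  split_ifs <;> fun_prop

/-- An affine map carries Lebesgue measure on `[0, 1]` to the uniform law. Truncating the length at
`0` matches the convention of a point mass at `a` when `b ≤ a`. -/
theorem uniformOnSegment_apply (a b : ℝ) {C : Set ℝ} (hC : MeasurableSet C) :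
    uniformOnSegment a b C =
      volume.restrict (Icc 0 1) {t : ℝ | a + max (b - a) 0 * t ∈ C} := by
  have hm : Measurable fun t : ℝ => a + max (b - a) 0 * t := by fun_prop
  have hC' : MeasurableSet {t : ℝ | a + max (b - a) 0 * t ∈ C} := hm hC
  rw [Measure.restrict_apply hC']
  unfold uniformOnSegment
  split_ifs with h
  · have hc : 0 < b - a := sub_pos.2 h
    rw [max_eq_left hc.le, Measure.smul_apply, Measure.restrict_apply hC, smul_eq_mul,
      Real.volume_Icc]
    have e : {t : ℝ | a + (b - a) * t ∈ C} ∩ Icc 0 1 =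
        (fun t => (b - a) * t) ⁻¹' ((fun t => a + t) ⁻¹' (C ∩ Icc a b)) := by
      ext t
      simp only [mem_inter_iff, mem_ofPred_eq, mem_Icc, mem_preimage]
      refine and_congr_right fun _ => and_congr ?_ ?_
      · constructor <;> intro h' <;> nlinarith
      · constructor <;> intro h' <;> nlinarith
    rw [e, Real.volume_preimage_mul_left hc.ne', measure_preimage_add, abs_of_pos (inv_pos.2 hc),
      ENNReal.ofReal_inv_of_pos hc]
  · rw [max_eq_right (by linarith), Measure.dirac_apply' _ hC]
    by_cases ha : a ∈ C <;> simp [ha]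

theorem nextEntryLaw_apply (p : ℝ) (γ : Measure ℝ≥0) (r : ℕ → ℕ → ℝ) (n k : ℕ) {C : Set ℝ}
    (hC : MeasurableSet C) :
    nextEntryLaw p γ r n k C = inputLaw γ k {t | fillEntry p r (fun i => r i n) k t ∈ C} := by
  unfold nextEntryLaw inputLaw fillEntry
  split_ifs
  · rfl
  · exact uniformOnSegment_apply _ _ hC

theorem inputLaw_compl_inputRange (γ : Measure ℝ≥0) (k : ℕ) :
    inputLaw γ k (inputRange k)ᶜ = 0 := by
  unfold inputLaw inputRange
  split_ifs
  · rw [Measure.map_apply (by fun_prop) measurableSet_Ici.compl]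
    convert measure_empty (μ := γ)
    ext t
    simp
  · rw [Measure.restrict_apply measurableSet_Icc.compl]
    simp

theorem inputLaw_pos (γ : Measure ℝ≥0) [γ.IsOpenPosMeasure] {k : ℕ} {t₀ : ℝ}
    (ht : t₀ ∈ inputRange k) {O : Set ℝ} (hO : IsOpen O) (htO : t₀ ∈ O) :
    0 < inputLaw γ k (inputRange k ∩ O) := by
  unfold inputLaw inputRange at *
  split_ifs at *
  · rw [Measure.map_apply (by fun_prop) (measurableSet_Ici.inter hO.measurableSet)]
    refine lt_of_lt_of_le ((hO.preimage NNReal.continuous_coe).measure_pos γ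
      ⟨⟨t₀, ht⟩, htO⟩) (measure_mono fun t h => ⟨t.2, h⟩)
  · rw [Measure.restrict_apply (measurableSet_Icc.inter hO.measurableSet)]
    have h1 : (O ∩ Ioo 0 1).Nonempty := by
      have : t₀ ∈ closure (Ioo (0 : ℝ) 1) := by
        rwa [closure_Ioo (by norm_num)]
      exact mem_closure_iff.1 this O hO htO
    refine lt_of_lt_of_le ((hO.inter isOpen_Ioo).measure_pos volume h1)
      (measure_mono fun t h => ⟨⟨Ioo_subset_Icc_self h.2, h.1⟩, Ioo_subset_Icc_self h.2⟩)

theorem lowerEnd_le_iff {p : ℝ} (hp : 0 < p) {r : ℕ → ℕ → ℝ} {v : ℕ → ℝ} {k : ℕ} (hk : k ≠ 0)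
    {s : ℝ} (hs : 0 ≤ s) :
    lowerEnd p r v k ≤ s ↔ ∀ i < k, |r i k ^ p - v i ^ p| ≤ s ^ p := by
  have : Nonempty (Fin k) := ⟨⟨0, Nat.pos_of_ne_zero hk⟩⟩
  unfold lowerEnd
  rw [ciSup_le_iff (Set.finite_range _).bddAbove]
  simp only [one_div, Real.rpow_inv_le_iff_of_pos (abs_nonneg _) hs hp]
  exact ⟨fun h i hi => h ⟨i, hi⟩, fun h i => h i i.2⟩

theorem lowerEnd_nonneg (p : ℝ) (r : ℕ → ℕ → ℝ) (v : ℕ → ℝ) (k : ℕ) : 0 ≤ lowerEnd p r v k :=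
  Real.iSup_nonneg fun _ => Real.rpow_nonneg (abs_nonneg _) _

theorem le_upperEnd_iff {p : ℝ} (hp : 0 < p) {r : ℕ → ℕ → ℝ} {v : ℕ → ℝ} {k : ℕ} (hk : k ≠ 0)
    (h0 : ∀ i < k, 0 ≤ r i k ^ p + v i ^ p) {s : ℝ} (hs : 0 ≤ s) :
    s ≤ upperEnd p r v k ↔ ∀ i < k, s ^ p ≤ r i k ^ p + v i ^ p := by
  have : Nonempty (Fin k) := ⟨⟨0, Nat.pos_of_ne_zero hk⟩⟩
  unfold upperEnd
  rw [le_ciInf_iff (Set.finite_range _).bddBelow]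
  simp only [one_div]
  constructor
  · intro h i hi
    exact (Real.le_rpow_inv_iff_of_pos hs (h0 i hi) hp).1 (h ⟨i, hi⟩)
  · intro h i
    exact (Real.le_rpow_inv_iff_of_pos hs (h0 i i.2) hp).2 (h i i.2)

/-- The value `s` of the distance to the point `k` is compatible with the distances `v` to the
points before it. -/
def IsCompatibleEntry (p : ℝ) (r : ℕ → ℕ → ℝ) (v : ℕ → ℝ) (k : ℕ) (s : ℝ) : Prop :=
  0 ≤ s ∧ ∀ i < k, |r i k ^ p - v i ^ p| ≤ s ^ p ∧ s ^ p ≤ r i k ^ p + v i ^ p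

/-- The inputs parametrize the compatible entries, provided that there are any. -/
theorem isCompatibleEntry_iff {p : ℝ} (hp : 0 < p) {r : ℕ → ℕ → ℝ} {v : ℕ → ℝ} {k : ℕ}
    (h0 : ∀ i < k, 0 ≤ r i k ^ p + v i ^ p)
    (h : ∀ i < k, ∀ j < k, |r i k ^ p - v i ^ p| ≤ r j k ^ p + v j ^ p) {s : ℝ} :
    IsCompatibleEntry p r v k s ↔ s ∈ fillEntry p r v k '' inputRange k := by
  unfold inputRange IsCompatibleEntry
  rcases eq_or_ne k 0 with rfl | hk
  · simp [fillEntry]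
  have hl := lowerEnd_nonneg p r v k
  -- Hypothesis `h` says that every lower bound is below every upper bound, so the segment is
  -- nonempty and the truncation in `fillEntry` is idle.
  have hlu : lowerEnd p r v k ≤ upperEnd p r v k := by
    rw [le_upperEnd_iff hp hk h0 hl]
    intro j hj
    have hj0 := h0 j hj
    have : lowerEnd p r v k ≤ (r j k ^ p + v j ^ p) ^ p⁻¹ := by
      rw [lowerEnd_le_iff hp hk (Real.rpow_nonneg hj0 _)]
      intro i hi
      rw [Real.rpow_inv_rpow hj0 hp.ne']
      exact h i hi j hj
    rwa [Real.le_rpow_inv_iff_of_pos hl hj0 hp] at this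
  have e : fillEntry p r v k '' Icc 0 1 = Icc (lowerEnd p r v k) (upperEnd p r v k) := by
    rw [← segment_eq_Icc hlu, segment_eq_image']
    refine image_congr fun t _ => ?_
    simp only [fillEntry, if_neg hk, max_eq_left (sub_nonneg.2 hlu), smul_eq_mul]
    ring
  rw [if_neg hk, e, mem_Icc]
  constructor
  · rintro ⟨hs, hi⟩
    exact ⟨(lowerEnd_le_iff hp hk hs).2 fun i hik => (hi i hik).1,
      (le_upperEnd_iff hp hk h0 hs).2 fun i hik => (hi i hik).2⟩
  · rintro ⟨h1, h2⟩
    have hs := hl.trans h1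
    exact ⟨hs, fun i hik => ⟨(lowerEnd_le_iff hp hk hs).1 h1 i hik,
      (le_upperEnd_iff hp hk h0 hs).1 h2 i hik⟩⟩

/-! ### Conditioning on the entries determined so far -/

/-- Two matrices agree on the entries that generate `fragmentAlgebra n k`. -/
def AgreeOnFragment (n k : ℕ) (r r' : ℕ → ℕ → ℝ) : Prop :=
  ∀ i j, (i < n ∧ j < n) ∨ (i < k ∧ j = n) → r i j = r' i j

theorem fragmentAlgebra_le (n k : ℕ) : fragmentAlgebra n k ≤ MeasurableSpace.pi := by
  refine Measurable.comap_le ?_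
  exact measurable_pi_lambda _ fun e => (measurable_pi_apply _).comp (measurable_pi_apply _)

theorem mem_iff_of_agreeOnFragment {n k : ℕ} {B : Set (ℕ → ℕ → ℝ)}
    (hB : MeasurableSet[fragmentAlgebra n k] B) {r r' : ℕ → ℕ → ℝ}
    (h : AgreeOnFragment n k r r') : r ∈ B ↔ r' ∈ B := by
  obtain ⟨B', -, rfl⟩ := hB
  simp only [mem_preimage]
  refine iff_of_eq (congrArg (· ∈ B') (funext fun e => h _ _ e.2))

/-- The matrix with the entries outside the fragment replaced by `0`. -/
def truncateToFragment (n k : ℕ) (r : ℕ → ℕ → ℝ) : ℕ → ℕ → ℝ :=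
  fun i j => if (i < n ∧ j < n) ∨ (i < k ∧ j = n) then r i j else 0

theorem agreeOnFragment_truncate (n k : ℕ) (r : ℕ → ℕ → ℝ) :
    AgreeOnFragment n k r (truncateToFragment n k r) := fun i j h => by
  rw [truncateToFragment, if_pos h]

theorem measurable_truncateToFragment (n k : ℕ) :
    Measurable[fragmentAlgebra n k] (truncateToFragment n k) := by
  let _ := fragmentAlgebra n k
  have h0 : Measurable fun (r : ℕ → ℕ → ℝ)
      (e : {e : ℕ × ℕ // (e.1 < n ∧ e.2 < n) ∨ (e.1 < k ∧ e.2 = n)}) => r e.1.1 e.1.2 :=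
    comap_measurable _
  refine measurable_pi_lambda _ fun i => measurable_pi_lambda _ fun j => ?_
  by_cases h : (i < n ∧ j < n) ∨ (i < k ∧ j = n)
  · simp only [truncateToFragment, if_pos h]
    exact measurable_pi_iff.1 h0 ⟨(i, j), h⟩
  · simp only [truncateToFragment, if_neg h]
    exact measurable_const

/-- A set that depends only on the fragment is its own preimage under truncation, and truncation is
measurable for the fragment algebra. -/
theorem measurableSet_fragmentAlgebra {n k : ℕ} {B : Set (ℕ → ℕ → ℝ)} (hB : MeasurableSet B)
    (h : ∀ r r', AgreeOnFragment n k r r' → r ∈ B → r' ∈ B) :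
    MeasurableSet[fragmentAlgebra n k] B := by
  have e : B = truncateToFragment n k ⁻¹' B := by
    ext r
    have h1 := agreeOnFragment_truncate n k r
    exact ⟨h _ _ h1, h _ _ fun i j hij => (h1 i j hij).symm⟩
  rw [e]
  exact measurable_truncateToFragment n k hB

/-- Averaging over the entry `r k n` when everything before it is known. -/
theorem IsRandomPMetricLaw.lintegral_entry {p : ℝ} {γ : Measure ℝ≥0} [IsProbabilityMeasure γ]
    {ν : Measure (ℕ → ℕ → ℝ)} (hν : IsRandomPMetricLaw p γ ν) {n k : ℕ} (hk : k < n)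
    {F : (ℕ → ℕ → ℝ) × ℝ → ℝ≥0∞} (hF : Measurable F)
    (hloc : ∀ r r' s, AgreeOnFragment n k r r' → F (r, s) = F (r', s)) :
    ∫⁻ r, F (r, r k n) ∂ν =
      ∫⁻ r, ∫⁻ t, F (r, fillEntry p r (fun i => r i n) k t) ∂inputLaw γ k ∂ν := by
  have := hν.isProbabilityMeasure
  have hT : Measurable (truncateToFragment n k) :=
    (measurable_truncateToFragment n k).mono (fragmentAlgebra_le n k) le_rfl
  have hentry : Measurable fun r : ℕ → ℕ → ℝ => r k n :=
    (measurable_pi_apply n).comp (measurable_pi_apply k)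
  have hcol : Measurable fun r : ℕ → ℕ → ℝ => fun i => r i n :=
    measurable_pi_lambda _ fun i => (measurable_pi_apply n).comp (measurable_pi_apply i)
  have hfill : Measurable fun q : (ℕ → ℕ → ℝ) × ℝ => fillEntry p q.1 (fun i => q.1 i n) k q.2 :=
    (measurable_fillEntry p k).comp (f := fun q : (ℕ → ℕ → ℝ) × ℝ => ((q.1, fun i => q.1 i n), q.2))
      ((measurable_fst.prodMk (hcol.comp measurable_fst)).prodMk measurable_snd)
  have hm1 : Measurable fun r : ℕ → ℕ → ℝ => (truncateToFragment n k r, r k n) :=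
    hT.prodMk hentry
  have hm2 : Measurable fun q : (ℕ → ℕ → ℝ) × ℝ =>
      (truncateToFragment n k q.1, fillEntry p q.1 (fun i => q.1 i n) k q.2) :=
    (hT.comp measurable_fst).prodMk hfill
  -- The conditional law, stated for sets, becomes an identity of joint laws once it is checked on
  -- rectangles.
  have key : ν.map (fun r => (truncateToFragment n k r, r k n)) =
      (ν.prod (inputLaw γ k)).map (fun q =>
        (truncateToFragment n k q.1, fillEntry p q.1 (fun i => q.1 i n) k q.2)) := by
    have : IsFiniteMeasure (ν.map (fun r => (truncateToFragment n k r, r k n))) :=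
      Measure.isFiniteMeasure_map _ _
    refine Measure.ext_prod fun {B C} hB hC => ?_
    rw [Measure.map_apply hm1 (hB.prod hC), Measure.map_apply hm2 (hB.prod hC),
      Measure.prod_apply (hm2 (hB.prod hC))]
    have h1 := hν.conditional_law n k hk _ (measurable_truncateToFragment n k hB) C hC
    refine h1.trans ?_
    rw [← lintegral_indicator (hT hB)]
    refine lintegral_congr fun r => ?_
    by_cases hr : r ∈ truncateToFragment n k ⁻¹' B
    · rw [indicator_of_mem hr, nextEntryLaw_apply _ _ _ _ _ hC]
      congr 1
      ext t
      simp [mem_preimage.1 hr]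
    · rw [indicator_of_notMem hr]
      rw [mem_preimage] at hr
      simp [preimage, hr]
  have e1 : ∀ r s, F (r, s) = F (truncateToFragment n k r, s) := fun r s =>
    hloc _ _ _ (agreeOnFragment_truncate n k r)
  calc ∫⁻ r, F (r, r k n) ∂ν = ∫⁻ r, F (truncateToFragment n k r, r k n) ∂ν :=
        lintegral_congr fun r => e1 _ _
    _ = ∫⁻ q, F q ∂(ν.map fun r => (truncateToFragment n k r, r k n)) :=
        (lintegral_map hF hm1).symm
    _ = ∫⁻ q, F (truncateToFragment n k q.1, fillEntry p q.1 (fun i => q.1 i n) k q.2)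
          ∂(ν.prod (inputLaw γ k)) := by rw [key, lintegral_map hF hm2]
    _ = ∫⁻ q, F (q.1, fillEntry p q.1 (fun i => q.1 i n) k q.2) ∂(ν.prod (inputLaw γ k)) :=
        lintegral_congr fun q => (e1 _ _).symm
    _ = _ := lintegral_prod _ (hF.comp (measurable_fst.prodMk hfill)).aemeasurable

/-! ### Hitting probabilities of new columns -/

/-- The probability that the beginning of a column lies in `S`, when its first `k` entries are
those of `v` and the following `j` entries, up to the order `k + j` of `S`, are random. -/
noncomputable def columnProb (p : ℝ) (γ : Measure ℝ≥0) (r : ℕ → ℕ → ℝ) (S : Set (ℕ → ℝ)) :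
    ℕ → ℕ → (ℕ → ℝ) → ℝ≥0∞
  | 0, _, v => S.indicator 1 v
  | j + 1, k, v => ∫⁻ t, columnProb p γ r S j (k + 1)
      (Function.update v k (fillEntry p r v k t)) ∂inputLaw γ k

theorem measurable_columnProb (p : ℝ) (γ : Measure ℝ≥0) [IsProbabilityMeasure γ]
    {S : Set (ℕ → ℝ)} (hS : MeasurableSet S) (j k : ℕ) :
    Measurable fun q : (ℕ → ℕ → ℝ) × (ℕ → ℝ) => columnProb p γ q.1 S j k q.2 := by
  induction j generalizing k with
  | zero => exact (measurable_one.indicator hS).comp measurable_snd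
  | succ j ih =>
    refine Measurable.lintegral_prod_right'
      (f := fun q : ((ℕ → ℕ → ℝ) × (ℕ → ℝ)) × ℝ => columnProb p γ q.1.1 S j (k + 1)
        (Function.update q.1.2 k (fillEntry p q.1.1 q.1.2 k q.2))) ?_
    refine (ih (k + 1)).comp (f := fun q : ((ℕ → ℕ → ℝ) × (ℕ → ℝ)) × ℝ =>
      (q.1.1, Function.update q.1.2 k (fillEntry p q.1.1 q.1.2 k q.2))) ?_
    refine (measurable_fst.comp measurable_fst).prodMk (measurable_pi_lambda _ fun i => ?_)
    rcases eq_or_ne i k with rfl | hik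
    · simpa only [Function.update_self] using measurable_fillEntry p i
    · simp only [Function.update_of_ne hik]
      exact (measurable_pi_apply i).comp (measurable_snd.comp measurable_fst)

theorem columnProb_congr (p : ℝ) (γ : Measure ℝ≥0) {r r' : ℕ → ℕ → ℝ} {S : Set (ℕ → ℝ)}
    (j k : ℕ) {v v' : ℕ → ℝ}
    (hS : ∀ v v' : ℕ → ℝ, (∀ i < k + j, v i = v' i) → v ∈ S → v' ∈ S)
    (hr : ∀ i < k + j, ∀ l < k + j, r i l = r' i l) (hv : ∀ i < k, v i = v' i) :
    columnProb p γ r S j k v = columnProb p γ r' S j k v' := by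
  induction j generalizing k v v' with
  | zero =>
    have : v ∈ S ↔ v' ∈ S := ⟨hS v v' hv, hS v' v fun i hi => (hv i hi).symm⟩
    simp only [columnProb]
    by_cases h : v ∈ S
    · rw [indicator_of_mem h, indicator_of_mem (this.1 h)]; rfl
    · rw [indicator_of_notMem h, indicator_of_notMem (mt this.2 h)]
  | succ j ih =>
    have e : k + 1 + j = k + (j + 1) := by omega
    refine lintegral_congr fun t => ih (k + 1) (by rwa [e]) (by rwa [e]) fun i hi => ?_
    rcases eq_or_ne i k with rfl | hik
    · rw [Function.update_self, Function.update_self]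
      exact fillEntry_congr p t (fun l hl => hr l (by omega) i (by omega)) hv
    · rw [Function.update_of_ne hik, Function.update_of_ne hik]
      exact hv i (by omega)

/-- The tower property: each step of the induction integrates out one more entry of column `m`, and
`B` depends only on earlier columns. -/
theorem IsRandomPMetricLaw.setLIntegral_columnProb {p : ℝ} {γ : Measure ℝ≥0}
    [IsProbabilityMeasure γ] {ν : Measure (ℕ → ℕ → ℝ)} (hν : IsRandomPMetricLaw p γ ν)
    {S : Set (ℕ → ℝ)} (hS : MeasurableSet S) {m : ℕ} {B : Set (ℕ → ℕ → ℝ)}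
    (hB : MeasurableSet[fragmentAlgebra m 0] B) (j k : ℕ) (hm : k + j ≤ m)
    (hS' : ∀ v v' : ℕ → ℝ, (∀ i < k + j, v i = v' i) → v ∈ S → v' ∈ S) :
    ∫⁻ r in B, columnProb p γ r S j k (fun i => r i m) ∂ν = ν (B ∩ {r | (fun i => r i m) ∈ S}) := by
  have hB' : MeasurableSet B := fragmentAlgebra_le _ _ _ hB
  have hcol : Measurable fun r : ℕ → ℕ → ℝ => fun i => r i m :=
    measurable_pi_lambda _ fun i => (measurable_pi_apply m).comp (measurable_pi_apply i)
  induction j generalizing k with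
  | zero =>
    have h1 : MeasurableSet {r : ℕ → ℕ → ℝ | (fun i => r i m) ∈ S} := hcol hS
    rw [inter_comm, ← Measure.restrict_apply h1, ← lintegral_indicator_one h1]
    rfl
  | succ j ih =>
    have e : k + 1 + j = k + (j + 1) := by omega
    have ih' := ih (k + 1) (by omega) (by rwa [e])
    rw [← ih', ← lintegral_indicator hB', ← lintegral_indicator hB']
    -- The integrand of the next stage with the entry in row `k` as a free variable. Otherwise it
    -- depends only on what is determined before that entry, so `lintegral_entry` applies.
    let F : (ℕ → ℕ → ℝ) × ℝ → ℝ≥0∞ := fun q => B.indicator (fun r => columnProb p γ r S j (k + 1)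
      (Function.update (fun i => r i m) k q.2)) q.1
    have hF : Measurable F := by
      have : F = (B ×ˢ univ).indicator (fun q => columnProb p γ q.1 S j (k + 1)
          (Function.update (fun i => q.1 i m) k q.2)) := by
        ext q
        by_cases hq : q.1 ∈ B <;> simp [F, hq]
      rw [this]
      refine Measurable.indicator ?_ (hB'.prod MeasurableSet.univ)
      refine (measurable_columnProb p γ hS j (k + 1)).comp (f := fun q : (ℕ → ℕ → ℝ) × ℝ =>
        (q.1, Function.update (fun i => q.1 i m) k q.2)) ?_
      refine measurable_fst.prodMk (measurable_pi_lambda _ fun i => ?_)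
      rcases eq_or_ne i k with rfl | hik
      · simpa only [Function.update_self] using measurable_snd
      · simp only [Function.update_of_ne hik]
        exact (measurable_pi_iff.1 hcol i).comp measurable_fst
    have hloc : ∀ r r' s, AgreeOnFragment m k r r' → F (r, s) = F (r', s) := by
      intro r r' s h
      have h1 : r ∈ B ↔ r' ∈ B := mem_iff_of_agreeOnFragment hB
        fun i l hil => h i l (Or.inl (by omega))
      have h2 : columnProb p γ r S j (k + 1) (Function.update (fun i => r i m) k s) =
          columnProb p γ r' S j (k + 1) (Function.update (fun i => r' i m) k s) := by
        refine columnProb_congr p γ j (k + 1) (by rwa [e])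
          (fun i hi l hl => h i l (Or.inl (by omega))) fun i hi => ?_
        rcases eq_or_ne i k with rfl | hik
        · rw [Function.update_self, Function.update_self]
        · rw [Function.update_of_ne hik, Function.update_of_ne hik]
          exact h i m (Or.inr (by omega))
      simp only [F]
      by_cases hr : r ∈ B
      · rw [indicator_of_mem hr, indicator_of_mem (h1.1 hr), h2]
      · rw [indicator_of_notMem hr, indicator_of_notMem (mt h1.2 hr)]
    have key := hν.lintegral_entry (by omega : k < m) hF hloc
    refine Eq.trans ?_ (key.symm.trans ?_)
    · refine lintegral_congr fun r => ?_
      by_cases hr : r ∈ B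
      · simp only [F, indicator_of_mem hr, columnProb]
      · simp only [F, indicator_of_notMem hr, lintegral_zero]
    · refine lintegral_congr fun r => ?_
      by_cases hr : r ∈ B
      · simp only [F, indicator_of_mem hr]
        congr 1
        exact Function.update_eq_self k (fun i => r i m)
      · simp only [F, indicator_of_notMem hr]

theorem measurableSet_columns {n : ℕ} {S : Set (Fin n → ℝ)} (hS : MeasurableSet S) :
    MeasurableSet {v : ℕ → ℝ | (fun i : Fin n => v i) ∈ S} :=
  (measurable_pi_lambda (fun (v : ℕ → ℝ) (i : Fin n) => v i) fun _ => measurable_pi_apply _) hS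

theorem mem_columns_congr {n : ℕ} {S : Set (Fin n → ℝ)} {v v' : ℕ → ℝ}
    (h : ∀ i < n, v i = v' i) (hv : v ∈ {v : ℕ → ℝ | (fun i : Fin n => v i) ∈ S}) :
    v' ∈ {v : ℕ → ℝ | (fun i : Fin n => v i) ∈ S} := by
  have : (fun i : Fin n => v i) = fun i : Fin n => v' i := funext fun i => h i i.2
  change (fun i : Fin n => v' i) ∈ S
  rw [← this]
  exact hv

/-- A set of columns that has positive probability is visited by some column of the matrix. -/
theorem IsRandomPMetricLaw.ae_exists_column_mem {p : ℝ} {γ : Measure ℝ≥0}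
    [IsProbabilityMeasure γ] {ν : Measure (ℕ → ℕ → ℝ)} (hν : IsRandomPMetricLaw p γ ν)
    {n : ℕ} {S : Set (Fin n → ℝ)} (hS : MeasurableSet S) :
    ∀ᵐ r ∂ν, 0 < columnProb p γ r {v | (fun i : Fin n => v i) ∈ S} n 0 0 →
      ∃ m, (fun i : Fin n => r i m) ∈ S := by
  have := hν.isProbabilityMeasure
  set S' : Set (ℕ → ℝ) := {v | (fun i : Fin n => v i) ∈ S} with hS'
  have hS'm : MeasurableSet S' := measurableSet_columns hS
  let lam : (ℕ → ℕ → ℝ) → ℝ≥0∞ := fun r => columnProb p γ r S' n 0 0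
  have hlam : Measurable lam :=
    (measurable_columnProb p γ hS'm n 0).comp (measurable_id.prodMk measurable_const)
  have hloc : ∀ v v' : ℕ → ℝ, (∀ i < 0 + n, v i = v' i) → v ∈ S' → v' ∈ S' := by
    intro v v' h hv
    exact mem_columns_congr (fun i hi => h i (by omega)) hv
  have hlamloc : ∀ r r' k, AgreeOnFragment (n + k) 0 r r' → lam r = lam r' := fun r r' k h =>
    columnProb_congr p γ n 0 hloc (fun i hi l hl => h i l (Or.inl (by omega))) (by simp)
  -- Columns are counted from `n` on, so that the corner of order `n`, and with it `lam`, is known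
  -- before each of them.
  let hit : ℕ → Set (ℕ → ℕ → ℝ) := fun M => {r | (fun i => r i (n + M)) ∈ S'}
  have hhit : ∀ M, MeasurableSet (hit M) := fun M =>
    (measurable_pi_lambda (fun (r : ℕ → ℕ → ℝ) i => r i (n + M)) fun i =>
      (measurable_pi_apply _).comp (measurable_pi_apply i)) hS'm
  -- The events that the first hit occurs at column `n + M`, with `δ ≤ lam`, are disjoint, and each
  -- has probability at least `δ` times that of never hitting. Infinitely many such events fit into
  -- total mass `1` only if the latter is `0`.
  have main : ∀ δ : ℝ≥0∞, 0 < δ → ν {r | δ ≤ lam r ∧ ∀ M, r ∉ hit M} = 0 := by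
    intro δ hδ
    let E : ℕ → Set (ℕ → ℕ → ℝ) := fun M => {r | δ ≤ lam r} ∩ ⋂ i ∈ Finset.range M, (hit i)ᶜ
    have hEm : ∀ M, MeasurableSet (E M) := fun M =>
      (measurableSet_le measurable_const hlam).inter
        (Finset.measurableSet_biInter _ fun i _ => (hhit i).compl)
    have hEf : ∀ M, MeasurableSet[fragmentAlgebra (n + M) 0] (E M) := by
      intro M
      refine measurableSet_fragmentAlgebra (hEm M) ?_
      rintro r r' h ⟨h1, h2⟩
      refine ⟨?_, ?_⟩
      · change δ ≤ lam r'
        rw [← hlamloc r r' M h]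
        exact h1
      · simp only [mem_iInter, Finset.mem_range] at h2 ⊢
        intro i hi h3
        have h4 : (fun l => r l (n + i)) ∈ S' :=
          mem_columns_congr (fun l hl => (h l (n + i) (Or.inl (by omega))).symm) h3
        exact h2 i hi h4
    have hEhit : ∀ M, δ * ν {r | δ ≤ lam r ∧ ∀ M, r ∉ hit M} ≤ ν (E M ∩ hit M) := by
      intro M
      have h1 := hν.setLIntegral_columnProb hS'm (hEf M) n 0 (by omega) hloc
      calc δ * ν {r | δ ≤ lam r ∧ ∀ M, r ∉ hit M} ≤ δ * ν (E M) := by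
            gcongr
            intro r hr
            exact ⟨hr.1, by simpa using fun i _ => hr.2 i⟩
        _ = ∫⁻ _ in E M, δ ∂ν := by rw [setLIntegral_const]
        _ ≤ ∫⁻ r in E M, lam r ∂ν := setLIntegral_mono' (hEm M) fun r hr => hr.1
        _ = ∫⁻ r in E M, columnProb p γ r S' n 0 (fun i => r i (n + M)) ∂ν :=
            lintegral_congr fun r => columnProb_congr p γ n 0 hloc (by simp) (by simp)
        _ = ν (E M ∩ hit M) := h1
    have hdisj : Pairwise (Function.onFun Disjoint fun M => E M ∩ hit M) := by
      have : ∀ i j, i < j → Disjoint (E i ∩ hit i) (E j ∩ hit j) := by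
        intro i j hij
        rw [Set.disjoint_left]
        rintro r ⟨-, h1⟩ ⟨⟨-, h2⟩, -⟩
        simp only [mem_iInter, Finset.mem_range] at h2
        exact h2 i hij h1
      intro i j hij
      rcases lt_or_gt_of_ne hij with h | h
      exacts [this i j h, (this j i h).symm]
    have hsum : ∑' M, ν (E M ∩ hit M) ≤ 1 := by
      rw [← measure_iUnion hdisj fun M => (hEm M).inter (hhit M)]
      exact prob_le_one
    by_contra hne
    have h2 : ∑' _ : ℕ, δ * ν {r | δ ≤ lam r ∧ ∀ M, r ∉ hit M} = ⊤ :=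
      ENNReal.tsum_const_eq_top_of_ne_zero (mul_ne_zero hδ.ne' hne)
    have h3 := (ENNReal.tsum_le_tsum hEhit).trans hsum
    rw [h2] at h3
    exact absurd h3 (by simp)
  have hall : ∀ᵐ r ∂ν, ∀ k : ℕ, ¬((k + 1 : ℝ≥0∞)⁻¹ ≤ lam r ∧ ∀ M, r ∉ hit M) := by
    rw [ae_all_iff]
    intro k
    rw [ae_iff]
    simp only [not_not]
    exact main _ (by simp)
  filter_upwards [hall] with r hr hpos
  obtain ⟨k, hk⟩ := ENNReal.exists_inv_nat_lt hpos.ne'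
  have h1 : ((k : ℝ≥0∞) + 1)⁻¹ ≤ lam r :=
    (ENNReal.inv_le_inv.2 le_self_add).trans hk.le
  have h2 := hr k
  push Not at h2
  obtain ⟨M, hM⟩ := h2 h1
  exact ⟨n + M, hM⟩

/-! ### Positivity of the hitting probabilities -/

/-- Changing one entry of an admissible vector slightly, the entries before it being fixed, can be
compensated by a small change of the entries after it. -/
theorem exists_admissible_perturbation {p : ℝ} (hp : 0 < p) {r : ℕ → ℕ → ℝ}
    (hr : IsPDistanceMatrix p r) {n k : ℕ} (hk : k < n) {a : ℕ → ℝ}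
    (ha : IsAdmissibleVector p (nwCorner n r) (fun i => a i)) {s : ℝ}
    (hs : IsCompatibleEntry p r a k s) :
    ∃ b : ℕ → ℝ, IsAdmissibleVector p (nwCorner n r) (fun i => b i) ∧ (∀ i < k, b i = a i) ∧
      b k = s ∧ ∃ h : ℕ → ℝ, (∀ i, b i = h i ^ p⁻¹) ∧ ∀ i < n, |h i - a i ^ p| ≤ |s ^ p - a k ^ p| := by
  have hrn : IsPDistanceMatrix p (nwCorner n r) :=
    ⟨fun i => hr.diag _, fun i j => hr.nonneg _ _, fun i j => hr.symm _ _,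
      fun i j l => hr.triangle _ _ _⟩
  obtain ⟨ha0, ha1, ha2⟩ := (isAdmissibleVector_iff hp hrn).1 ha
  have A0 : ∀ i < n, 0 ≤ a i := fun i hi => ha0 ⟨i, hi⟩
  have A1 : ∀ i < n, ∀ j < n, r i j ^ p ≤ a i ^ p + a j ^ p := fun i hi j hj =>
    ha1 ⟨i, hi⟩ ⟨j, hj⟩
  have A2 : ∀ i < n, ∀ j < n, a i ^ p ≤ a j ^ p + r i j ^ p := fun i hi j hj =>
    ha2 ⟨i, hi⟩ ⟨j, hj⟩
  have hsm : ∀ i j, r i j ^ p = r j i ^ p := fun i j => by rw [hr.symm]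
  have hD0 : ∀ i, r i i ^ p = 0 := fun i => by rw [hr.diag, Real.zero_rpow hp.ne']
  have hDn : ∀ i j, 0 ≤ r i j ^ p := fun i j => Real.rpow_nonneg (hr.nonneg i j) p
  have hθ := abs_le.1 (le_refl |s ^ p - a k ^ p|)
  have hθ0 := abs_nonneg (s ^ p - a k ^ p)
  generalize |s ^ p - a k ^ p| = θ at hθ hθ0 ⊢
  have hsp : 0 ≤ s ^ p := Real.rpow_nonneg hs.1 p
  have hc : ∀ i < k, r i k ^ p ≤ s ^ p + a i ^ p ∧ a i ^ p ≤ s ^ p + r i k ^ p ∧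
      s ^ p ≤ r i k ^ p + a i ^ p := by
    intro i hi
    obtain ⟨h1, h2⟩ := hs.2 i hi
    have := abs_le.1 h1
    exact ⟨by linarith, by linarith, h2⟩
  -- The bounds keep the entries before `k`, put the new value at `k`, and leave a slack `θ` after
  -- `k`. The slack absorbs the change at `k`, so the minimal extension attains the bounds up to
  -- `k`; and since all bounds are within `θ` of the Katětov function `a ^ p`, so is the extension.
  let c : Fin n → ℝ := fun i => if (i : ℕ) < k then a i ^ p else if (i : ℕ) = k then s ^ p
    else a i ^ p + θ
  have clt : ∀ i : Fin n, (i : ℕ) < k → c i = a i ^ p := fun i hi => by simp [c, hi]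
  have ceq : ∀ i : Fin n, (i : ℕ) = k → c i = s ^ p := fun i hi => by simp [c, hi]
  have cgt : ∀ i : Fin n, k < (i : ℕ) → c i = a i ^ p + θ := fun i hi => by
    simp [c, hi.ne', hi.not_gt]
  have : Nonempty (Fin n) := ⟨⟨k, hk⟩⟩
  obtain ⟨h, k1, k2, k3, k4⟩ := exists_minExtension (D := fun i j : ℕ => r i j ^ p) hsm
    (fun i j l => hr.triangle i l j) (fun i : Fin n => (i : ℕ)) c (by
      intro i j
      have h1 := A1 i i.2 j j.2
      have e1 := hc i
      have e2 := hc j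
      rw [hsm j k] at e2
      rcases lt_trichotomy (i : ℕ) k with hi | hi | hi <;>
      rcases lt_trichotomy (j : ℕ) k with hj | hj | hj
      · rw [clt i hi, clt j hj]; exact h1
      · rw [clt i hi, ceq j hj, hj]; linarith [e1 hi]
      · rw [clt i hi, cgt j hj]; linarith
      · rw [ceq i hi, clt j hj, hi]; linarith [e2 hj]
      · rw [ceq i hi, ceq j hj, hi, hj, hD0]; linarith
      · rw [ceq i hi, cgt j hj]; rw [hi] at h1 ⊢; linarith
      · rw [cgt i hi, clt j hj]; linarith
      · rw [cgt i hi, ceq j hj]; rw [hj] at h1 ⊢; linarith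
      · rw [cgt i hi, cgt j hj]; linarith)
  have up : ∀ i : Fin n, h i ≤ c i := fun i => by
    have := k3 i i
    rwa [hD0, add_zero] at this
  have cle : ∀ i : Fin n, c i ≤ a i ^ p + θ ∧ a i ^ p - θ ≤ c i := fun i => by
    rcases lt_trichotomy (i : ℕ) k with hi | hi | hi
    · rw [clt i hi]; constructor <;> linarith
    · rw [ceq i hi, hi]; constructor <;> linarith
    · rw [cgt i hi]; constructor <;> linarith
  have e : ∀ i : Fin n, (i : ℕ) ≤ k → h i = c i := by
    intro i hik
    refine le_antisymm (up i) ?_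
    obtain ⟨j, hj⟩ := k4 i
    rw [hj]
    have h1 := A2 i i.2 j j.2
    have e1 := hc i
    have e2 := hc j
    rcases hik.lt_or_eq with hi | hi <;>
    rcases lt_trichotomy (j : ℕ) k with hj | hj | hj
    · rw [clt i hi, clt j hj]; exact h1
    · rw [clt i hi, ceq j hj, hj]; linarith [e1 hi]
    · rw [clt i hi, cgt j hj]; linarith
    · rw [ceq i hi, clt j hj, hi, hsm]; linarith [e2 hj]
    · rw [ceq i hi, ceq j hj, hi, hj, hD0]; linarith
    · rw [ceq i hi, cgt j hj]; rw [hi] at h1 ⊢; linarith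
  obtain ⟨-, hadm⟩ := isAdmissibleVector_rpow_inv hp hr (h := h) k1 k2
  refine ⟨fun i => h i ^ p⁻¹, ?_, ?_, ?_, h, fun _ => rfl, ?_⟩
  · exact (isAdmissibleVector_rpow_inv hp hrn (h := fun i : Fin n => h i)
      (fun i j => k1 i j) (fun i j => k2 i j)).2
  · intro i hi
    dsimp only
    rw [e ⟨i, hi.trans hk⟩ hi.le, clt _ hi, Real.rpow_rpow_inv (A0 i (hi.trans hk)) hp.ne']
  · dsimp only
    rw [e ⟨k, hk⟩ le_rfl, ceq _ rfl, Real.rpow_rpow_inv hs.1 hp.ne']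
  · intro i hi
    obtain ⟨j, hj⟩ := k4 i
    have h1 := up ⟨i, hi⟩
    have h2 := (cle ⟨i, hi⟩).1
    have h3 := (cle j).2
    have h4 := A2 i hi j j.2
    dsimp only at h1 h2
    rw [abs_le]
    constructor <;> linarith

/-- Inputs near the one that reproduces `a k` have positive probability. For each of them the
remaining target is corrected to an admissible vector still in `S`, which is why the induction
ranges over `a`. -/
theorem columnProb_pos {p : ℝ} (hp : 0 < p) (γ : Measure ℝ≥0) [IsProbabilityMeasure γ]
    [γ.IsOpenPosMeasure] {r : ℕ → ℕ → ℝ} (hr : IsPDistanceMatrix p r) {n : ℕ}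
    {S : Set (Fin n → ℝ)} (hS : IsOpen S) (j k : ℕ) (hjk : k + j = n) {v a : ℕ → ℝ}
    (ha : IsAdmissibleVector p (nwCorner n r) (fun i => a i)) (haS : (fun i : Fin n => a i) ∈ S)
    (hv : ∀ i < k, v i = a i) :
    0 < columnProb p γ r {v | (fun i : Fin n => v i) ∈ S} j k v := by
  induction j generalizing k v a with
  | zero =>
    have : v ∈ {v : ℕ → ℝ | (fun i : Fin n => v i) ∈ S} :=
      mem_columns_congr (fun i hi => (hv i (by omega)).symm) haS
    simp only [columnProb]
    rw [indicator_of_mem this]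
    exact one_pos
  | succ j ih =>
    have hk : k < n := by omega
    have hrn : IsPDistanceMatrix p (nwCorner n r) :=
      ⟨fun i => hr.diag _, fun i j => hr.nonneg _ _, fun i j => hr.symm _ _,
        fun i j l => hr.triangle _ _ _⟩
    obtain ⟨ha0, ha1, ha2⟩ := (isAdmissibleVector_iff hp hrn).1 ha
    have A0 : ∀ i < n, 0 ≤ a i := fun i hi => ha0 ⟨i, hi⟩
    have A1 : ∀ i < n, ∀ j < n, r i j ^ p ≤ a i ^ p + a j ^ p := fun i hi j hj =>
      ha1 ⟨i, hi⟩ ⟨j, hj⟩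
    have A2 : ∀ i < n, ∀ j < n, a i ^ p ≤ a j ^ p + r i j ^ p := fun i hi j hj =>
      ha2 ⟨i, hi⟩ ⟨j, hj⟩
    have hsm : ∀ i j, r i j ^ p = r j i ^ p := fun i j => by rw [hr.symm]
    have hDn : ∀ i j, 0 ≤ r i j ^ p := fun i j => Real.rpow_nonneg (hr.nonneg i j) p
    have hiff : ∀ s, IsCompatibleEntry p r a k s ↔ s ∈ fillEntry p r a k '' inputRange k := by
      intro s
      refine isCompatibleEntry_iff hp (fun i hi => ?_) fun i hi j hj => ?_
      · exact add_nonneg (hDn _ _) (Real.rpow_nonneg (A0 i (by omega)) p)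
      · have b1 := A1 i (by omega) j (by omega)
        have b2 := A2 i (by omega) j (by omega)
        have b3 := hr.triangle i k j
        have b4 := hr.triangle i j k
        have b5 := hsm j k
        rw [abs_le]
        constructor <;> linarith
    have hak : IsCompatibleEntry p r a k (a k) := by
      refine ⟨A0 k hk, fun i hi => ?_⟩
      have b1 := A1 i (by omega) k hk
      have b2 := A2 i (by omega) k hk
      have b3 := A2 k hk i (by omega)
      rw [hsm k i] at b3
      exact ⟨abs_le.2 ⟨by linarith, by linarith⟩, by linarith⟩
    obtain ⟨t₀, ht₀, hta⟩ := (hiff _).1 hak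
    have hcont : Continuous fun (w : Fin n → ℝ) i => w i ^ p⁻¹ :=
      continuous_pi fun i => (continuous_apply i).rpow_const fun _ => Or.inr (by positivity)
    have hpre : (fun i : Fin n => a i ^ p) ∈ (fun (w : Fin n → ℝ) i => w i ^ p⁻¹) ⁻¹' S := by
      rw [mem_preimage]
      convert haS using 2 with i
      exact Real.rpow_rpow_inv (A0 i i.2) hp.ne'
    -- The tolerance is taken for `p`-th powers, where the correction costs no more than the change
    -- of the entry.
    obtain ⟨θ, hθ, hball⟩ := Metric.isOpen_iff.1 (hS.preimage hcont) _ hpre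
    let O : Set ℝ := {t | |fillEntry p r a k t ^ p - a k ^ p| < θ}
    have hO : IsOpen O := isOpen_lt ((((continuous_fillEntry p r a k).rpow_const
      fun _ => Or.inr hp.le).sub continuous_const).abs) continuous_const
    have htO : t₀ ∈ O := by
      change |_| < θ
      rw [hta, sub_self, abs_zero]
      exact hθ
    have hμ := inputLaw_pos γ ht₀ hO htO
    have hm : Measurable fun t => columnProb p γ r {v | (fun i : Fin n => v i) ∈ S} j (k + 1)
        (Function.update v k (fillEntry p r v k t)) := by
      refine (measurable_columnProb p γ (measurableSet_columns hS.measurableSet) j (k + 1)).comp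
        (f := fun t => (r, Function.update v k (fillEntry p r v k t))) ?_
      refine measurable_const.prodMk ?_
      exact (measurable_update v).comp (continuous_fillEntry p r v k).measurable
    simp only [columnProb]
    rw [lintegral_pos_iff_support hm]
    refine hμ.trans_le (measure_mono ?_)
    rintro t ⟨ht, htO'⟩
    obtain ⟨b, hb, hba, hbk, h, hbh, hh⟩ := exists_admissible_perturbation hp hr hk ha
      ((hiff _).2 ⟨t, ht, rfl⟩)
    refine (ih (k + 1) (by omega) hb ?_ ?_).ne'
    · have : (fun i : Fin n => h i) ∈ Metric.ball (fun i : Fin n => a i ^ p) θ := by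
        rw [Metric.mem_ball, dist_pi_lt_iff hθ]
        intro i
        exact (hh i i.2).trans_lt htO'
      have := hball this
      rw [mem_preimage] at this
      simpa only [hbh] using this
    · intro i hi
      rcases eq_or_ne i k with rfl | hik
      · rw [Function.update_self, hbk]
        refine fillEntry_congr p t (fun _ _ => rfl) hv
      · rw [Function.update_of_ne hik, hba i (by omega)]
        exact hv i (by omega)

/-! ### Almost sure universality and properness -/

theorem IsRandomPMetricLaw.ae_isUniversal {p : ℝ} (hp : 0 < p) {γ : Measure ℝ≥0}
    [IsProbabilityMeasure γ] [γ.IsOpenPosMeasure] {ν : Measure (ℕ → ℕ → ℝ)}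
    (hν : IsRandomPMetricLaw p γ ν) : ∀ᵐ r ∂ν, IsUniversalPDistanceMatrix p r := by
  have hall : ∀ᵐ r ∂ν, ∀ (n : ℕ) (q : Fin n → ℚ) (l : ℕ),
      0 < columnProb p γ r {v | (fun i : Fin n => v i) ∈
        Metric.ball (fun i : Fin n => (q i : ℝ)) (1 / (l + 1))} n 0 0 →
      ∃ m, (fun i : Fin n => r i m) ∈ Metric.ball (fun i : Fin n => (q i : ℝ)) (1 / (l + 1)) := by
    simp only [ae_all_iff]
    intro n q l
    exact hν.ae_exists_column_mem Metric.isOpen_ball.measurableSet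
  filter_upwards [hall, hν.ae_isPDistanceMatrix] with r h hr
  refine ⟨hr, fun ε hε n a ha => ?_⟩
  obtain ⟨l, hl⟩ := exists_nat_one_div_lt (half_pos hε)
  have hl0 : (0 : ℝ) < 1 / (l + 1) := by positivity
  have hq : ∀ i, ∃ q : ℚ, |a i - q| < 1 / (l + 1) := fun i => by
    obtain ⟨q, hq1, hq2⟩ := exists_rat_btwn (show a i < a i + 1 / (l + 1) by linarith)
    exact ⟨q, abs_lt.2 ⟨by linarith, by linarith⟩⟩
  choose q hq using hq
  have hext : (fun i : Fin n => (fun i : ℕ => if hi : i < n then a ⟨i, hi⟩ else 0) i) = a := by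
    ext i
    simp
  obtain ⟨m, hm⟩ := h n q l (columnProb_pos hp γ hr Metric.isOpen_ball n 0 (by omega)
    (a := fun i => if hi : i < n then a ⟨i, hi⟩ else 0) (by rwa [hext])
    (by
      rw [hext, Metric.mem_ball, dist_pi_lt_iff hl0]
      exact hq) (by simp))
  refine ⟨m, fun i => ?_⟩
  rw [Metric.mem_ball, dist_pi_lt_iff hl0] at hm
  have h1 := abs_lt.1 (hm i)
  have h2 := abs_lt.1 (hq i)
  rw [abs_lt]
  constructor <;> linarith

/-- A zero `r i j` forces `r 0 i = r 0 j` by the triangle inequality, but a fresh entry of the first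
row, having a law without atoms, almost surely differs from all earlier ones, including `r 0 0`. -/
theorem IsRandomPMetricLaw.ae_isProperMatrix {p : ℝ} (hp : 1 ≤ p) {γ : Measure ℝ≥0}
    [IsProbabilityMeasure γ] [NullSingletonClass γ] {ν : Measure (ℕ → ℕ → ℝ)}
    (hν : IsRandomPMetricLaw p γ ν) : ∀ᵐ r ∂ν, IsProperMatrix r := by
  have h0 : ∀ x, inputLaw γ 0 {x} = 0 := by
    intro x
    rw [inputLaw, if_pos rfl, Measure.map_apply (by fun_prop) (measurableSet_singleton x)]
    exact (Set.subsingleton_singleton.preimage NNReal.coe_injective).measure_zero γ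
  have hne : ∀ᵐ r ∂ν, ∀ n k, k < n → r 0 n ≠ r 0 k := by
    simp only [ae_all_iff]
    intro n k hk
    have hd : MeasurableSet {q : (ℕ → ℕ → ℝ) × ℝ | q.2 = q.1 0 k} :=
      measurableSet_eq_fun measurable_snd
        ((measurable_pi_apply k).comp ((measurable_pi_apply 0).comp measurable_fst))
    have key := hν.lintegral_entry (Nat.zero_lt_of_lt hk : 0 < n)
      (F := {q : (ℕ → ℕ → ℝ) × ℝ | q.2 = q.1 0 k}.indicator 1)
      (measurable_one.indicator hd) (by
        intro r r' s h
        have := h 0 k (Or.inl (by omega))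
        simp [indicator, this])
    have hd' : MeasurableSet {r : ℕ → ℕ → ℝ | r 0 n = r 0 k} :=
      measurableSet_eq_fun ((measurable_pi_apply n).comp (measurable_pi_apply 0))
        ((measurable_pi_apply k).comp (measurable_pi_apply 0))
    have h1 : ∫⁻ r, {q : (ℕ → ℕ → ℝ) × ℝ | q.2 = q.1 0 k}.indicator 1 (r, r 0 n) ∂ν =
        ν {r | r 0 n = r 0 k} := by
      rw [← lintegral_indicator_one hd']
      rfl
    have h2 : ∀ r : ℕ → ℕ → ℝ, ∫⁻ t, {q : (ℕ → ℕ → ℝ) × ℝ | q.2 = q.1 0 k}.indicator 1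
        (r, fillEntry p r (fun i => r i n) 0 t) ∂inputLaw γ 0 = 0 := by
      intro r
      rw [← h0 (r 0 k), ← lintegral_indicator_one (measurableSet_singleton _)]
      rfl
    rw [h1, lintegral_congr h2, lintegral_zero] at key
    rw [ae_iff]
    simpa using key
  filter_upwards [hne, hν.ae_isPDistanceMatrix] with r h hr i j hij hz
  have e : r 0 i = r 0 j := by
    have h1 := hr.dist_triangle hp 0 i j
    have h2 := hr.dist_triangle hp 0 j i
    rw [hr.symm j i] at h2
    linarith
  rcases lt_or_gt_of_ne hij with hlt | hlt
  · exact h j i hlt e.symm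
  · exact h i j hlt e

/-! ### Existence of the random law -/

/-- The entry in the row `k` and the column `n > k` of the random matrix, as a function of the
inputs. -/
noncomputable def inputEntry (p : ℝ) (ω : ℕ × ℕ → ℝ) (k n : ℕ) : ℝ :=
  if _h : k < n then
    if k = 0 then ω (k, n)
    else
      (⨆ i : Fin k, |inputEntry p ω i k ^ p - inputEntry p ω i n ^ p| ^ (1 / p)) +
        max ((⨅ i : Fin k, (inputEntry p ω i k ^ p + inputEntry p ω i n ^ p) ^ (1 / p)) -
          ⨆ i : Fin k, |inputEntry p ω i k ^ p - inputEntry p ω i n ^ p| ^ (1 / p)) 0 * ω (k, n)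
  else 0
termination_by (n, k)
decreasing_by
  all_goals first
    | exact Prod.Lex.left _ _ _h
    | exact Prod.Lex.right _ i.2

/-- The random matrix as a function of the inputs. -/
noncomputable def inputMatrix (p : ℝ) (ω : ℕ × ℕ → ℝ) (i j : ℕ) : ℝ :=
  if i < j then inputEntry p ω i j else inputEntry p ω j i

theorem inputMatrix_self (p : ℝ) (ω : ℕ × ℕ → ℝ) (i : ℕ) : inputMatrix p ω i i = 0 := by
  rw [inputMatrix, if_neg (lt_irrefl i), inputEntry, dif_neg (lt_irrefl i)]

theorem inputMatrix_symm (p : ℝ) (ω : ℕ × ℕ → ℝ) (i j : ℕ) :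
    inputMatrix p ω i j = inputMatrix p ω j i := by
  unfold inputMatrix
  rcases lt_trichotomy i j with h | rfl | h
  · rw [if_pos h, if_neg h.not_gt]
  · rfl
  · rw [if_neg h.not_gt, if_pos h]

theorem inputMatrix_eq_fillEntry (p : ℝ) (ω : ℕ × ℕ → ℝ) {k n : ℕ} (h : k < n) :
    inputMatrix p ω k n =
      fillEntry p (inputMatrix p ω) (fun i => inputMatrix p ω i n) k (ω (k, n)) := by
  have e1 : ∀ i : Fin k, inputMatrix p ω i k = inputEntry p ω i k := fun i => by
    rw [inputMatrix, if_pos i.2]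
  have e2 : ∀ i : Fin k, inputMatrix p ω i n = inputEntry p ω i n := fun i => by
    rw [inputMatrix, if_pos (i.2.trans h)]
  rw [inputMatrix, if_pos h, inputEntry, dif_pos h]
  simp only [fillEntry, lowerEnd, upperEnd, e1, e2]

/-- Induction along the order in which the entries of the matrix are determined. -/
theorem entry_induction {P : ℕ → ℕ → Prop}
    (h : ∀ k n, k < n → (∀ i < k, P i k) → (∀ i < k, P i n) → P k n) : ∀ k n, k < n → P k n := by
  intro k n hkn
  induction n using Nat.strong_induction_on generalizing k with
  | _ n ihn =>
    induction k using Nat.strong_induction_on with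
    | _ k ihk => exact h k n hkn (fun i hi => ihn k hkn i hi) fun i hi => ihk i hi (hi.trans hkn)

theorem measurable_inputMatrix (p : ℝ) : Measurable (inputMatrix p) := by
  have key : ∀ k n, k < n → Measurable fun ω => inputMatrix p ω k n := by
    refine entry_induction fun k n hkn h1 h2 => ?_
    have hl : Measurable fun ω => lowerEnd p (inputMatrix p ω) (fun i => inputMatrix p ω i n) k :=
      Measurable.iSup fun i => (((h1 i i.2).pow_const p).sub ((h2 i i.2).pow_const p)).abs.pow_const _
    have hu : Measurable fun ω => upperEnd p (inputMatrix p ω) (fun i => inputMatrix p ω i n) k :=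
      Measurable.iInf fun i => (((h1 i i.2).pow_const p).add ((h2 i i.2).pow_const p)).pow_const _
    simp only [inputMatrix_eq_fillEntry p _ hkn, fillEntry]
    split_ifs
    · exact measurable_pi_apply _
    · exact hl.add (((hu.sub hl).max measurable_const).mul (measurable_pi_apply _))
  refine measurable_pi_lambda _ fun i => measurable_pi_lambda _ fun j => ?_
  rcases lt_trichotomy i j with h | rfl | h
  · exact key i j h
  · simp only [inputMatrix_self]
    exact measurable_const
  · simp only [inputMatrix_symm p _ i j]
    exact key j i h

/-- An entry uses only the inputs at its own position and at positions determined before it. -/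
theorem inputMatrix_update_agree (p : ℝ) (ω : ℕ × ℕ → ℝ) {k n : ℕ} (hkn : k < n) (t : ℝ) :
    AgreeOnFragment n k (inputMatrix p (Function.update ω (k, n) t)) (inputMatrix p ω) := by
  have key : ∀ i j, i < j → (j < n ∨ (j = n ∧ i < k)) →
      inputMatrix p (Function.update ω (k, n) t) i j = inputMatrix p ω i j := by
    refine entry_induction fun i j hij h1 h2 h => ?_
    rw [inputMatrix_eq_fillEntry p _ hij, inputMatrix_eq_fillEntry p _ hij,
      Function.update_of_ne (by rintro ⟨⟩; omega)]
    exact fillEntry_congr p _ (fun l hl => h1 l hl (by omega)) fun l hl => h2 l hl (by omega)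
  intro i j h
  rcases lt_trichotomy i j with hij | rfl | hij
  · exact key i j hij (by omega)
  · rw [inputMatrix_self, inputMatrix_self]
  · rw [inputMatrix_symm, inputMatrix_symm p ω]
    exact key j i hij (by omega)

/-- A matrix whose entries are compatible with the entries that precede them is a `p`-distance
matrix. -/
theorem isPDistanceMatrix_of_fillEntry {p : ℝ} (hp : 0 < p) {r : ℕ → ℕ → ℝ}
    (hd : ∀ i, r i i = 0) (hs : ∀ i j, r i j = r j i)
    (hf : ∀ k n, k < n → r k n ∈ fillEntry p r (fun i => r i n) k '' inputRange k) :
    IsPDistanceMatrix p r := by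
  have hsm : ∀ i j, r i j ^ p = r j i ^ p := fun i j => by rw [hs]
  have hD0 : ∀ i, r i i ^ p = 0 := fun i => by rw [hd, Real.zero_rpow hp.ne']
  have key : ∀ n, ∀ i < n, ∀ j < n, 0 ≤ r i j ∧ ∀ l < n, r i j ^ p ≤ r i l ^ p + r l j ^ p := by
    intro n
    induction n with
    | zero => intro i hi; omega
    | succ n ih =>
      have hnn : ∀ i < n, ∀ j < n, 0 ≤ r i j ^ p := fun i hi j hj =>
        Real.rpow_nonneg (ih i hi j hj).1 p
      -- The first `k` distances from the new point `n` form an admissible vector. This makes the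
      -- segment for the next entry nonempty, so that the entry is compatible and the vector grows
      -- by one.
      have col : ∀ k ≤ n, ∀ i < k, 0 ≤ r i n ∧ ∀ j < k, r i j ^ p ≤ r i n ^ p + r j n ^ p ∧
          r i n ^ p ≤ r j n ^ p + r i j ^ p := by
        intro k
        induction k with
        | zero => intro _ i hi; omega
        | succ k ihk =>
          intro hk
          have ihk' := ihk (by omega)
          have hc : IsCompatibleEntry p r (fun i => r i n) k (r k n) := by
            refine (isCompatibleEntry_iff hp (fun i hi => ?_) fun i hi j hj => ?_).2
              (hf k n (by omega))
            · exact add_nonneg (hnn _ (by omega) _ (by omega))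
                (Real.rpow_nonneg (ihk' i hi).1 p)
            · obtain ⟨b1, b2⟩ := (ihk' i hi).2 j hj
              have b3 := (ih i (by omega) k (by omega)).2 j (by omega)
              have b4 := (ih i (by omega) j (by omega)).2 k (by omega)
              have b5 := hsm j k
              rw [abs_le]
              constructor <;> linarith
          obtain ⟨hc0, hc1⟩ := hc
          have hc2 : ∀ i < k, r i k ^ p ≤ r i n ^ p + r k n ^ p ∧
              r i n ^ p ≤ r k n ^ p + r i k ^ p ∧ r k n ^ p ≤ r i n ^ p + r i k ^ p := by
            intro i hi
            obtain ⟨h1, h2⟩ := hc1 i hi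
            have := abs_le.1 h1
            dsimp only at h2 this
            exact ⟨by linarith, by linarith, by linarith⟩
          intro i hi
          rcases (Nat.lt_succ_iff_lt_or_eq.1 hi) with hi | rfl
          · refine ⟨(ihk' i hi).1, fun j hj => ?_⟩
            rcases (Nat.lt_succ_iff_lt_or_eq.1 hj) with hj | rfl
            · exact (ihk' i hi).2 j hj
            · exact ⟨(hc2 i hi).1, (hc2 i hi).2.1⟩
          · refine ⟨hc0, fun j hj => ?_⟩
            have := Real.rpow_nonneg hc0 p
            rcases (Nat.lt_succ_iff_lt_or_eq.1 hj) with hj | rfl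
            · rw [hsm i j]
              exact ⟨by linarith [(hc2 j hj).1], (hc2 j hj).2.2⟩
            · rw [hD0]
              exact ⟨by linarith, by linarith⟩
      have coln := col n le_rfl
      intro i hi j hj
      rcases (Nat.lt_succ_iff_lt_or_eq.1 hi) with hi | rfl <;>
      rcases (Nat.lt_succ_iff_lt_or_eq.1 hj) with hj | rfl
      · refine ⟨(ih i hi j hj).1, fun l hl => ?_⟩
        rcases (Nat.lt_succ_iff_lt_or_eq.1 hl) with hl | rfl
        · exact (ih i hi j hj).2 l hl
        · rw [hsm l j]
          exact ((coln i hi).2 j hj).1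
      · refine ⟨(coln i hi).1, fun l hl => ?_⟩
        rcases (Nat.lt_succ_iff_lt_or_eq.1 hl) with hl | rfl
        · linarith [((coln i hi).2 l hl).2]
        · rw [hD0]; linarith
      · refine ⟨hs i j ▸ (coln j hj).1, fun l hl => ?_⟩
        rcases (Nat.lt_succ_iff_lt_or_eq.1 hl) with hl | rfl
        · rw [hsm i j, hsm i l, hsm l j]
          exact ((coln j hj).2 l hl).2
        · rw [hD0]; linarith
      · refine ⟨(hd _).ge, fun l hl => ?_⟩
        rw [hD0]
        rcases (Nat.lt_succ_iff_lt_or_eq.1 hl) with hl | rfl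
        · have := Real.rpow_nonneg (coln l hl).1 p
          rw [hsm _ l]
          linarith
        · rw [hD0]; norm_num
  refine ⟨hd, fun i j => ?_, hs, fun i j l => ?_⟩
  · exact (key (max i j + 1) i (by omega) j (by omega)).1
  · exact (key (max (max i j) l + 1) i (by omega) j (by omega)).2 l (by omega)

/-- Resampling one coordinate independently preserves a product measure; it suffices to check
cylinders. -/
theorem map_update_infinitePi {ι : Type*} [DecidableEq ι] {X : ι → Type*}
    [∀ i, MeasurableSpace (X i)] (μ : ∀ i, Measure (X i)) [∀ i, IsProbabilityMeasure (μ i)]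
    (e : ι) :
    ((Measure.infinitePi μ).prod (μ e)).map (fun q => Function.update q.1 e q.2) =
      Measure.infinitePi μ := by
  have hm : Measurable fun q : (∀ i, X i) × X e => Function.update q.1 e q.2 :=
    measurable_update'
  refine Measure.eq_infinitePi _ fun s t ht => ?_
  rw [Measure.map_apply hm (MeasurableSet.pi s.countable_toSet fun i _ => ht i)]
  by_cases he : e ∈ s
  · have : (fun q : (∀ i, X i) × X e => Function.update q.1 e q.2) ⁻¹' (s : Set ι).pi t =
        ((s.erase e : Finset ι) : Set ι).pi t ×ˢ t e := by
      ext q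
      simp only [mem_preimage, Set.mem_pi, Finset.mem_coe, mem_prod, Finset.mem_erase]
      constructor
      · intro h
        refine ⟨fun i hi => ?_, ?_⟩
        · have := h i hi.2
          rwa [Function.update_of_ne hi.1] at this
        · have := h e he
          rwa [Function.update_self] at this
      · rintro ⟨h1, h2⟩ i hi
        rcases eq_or_ne i e with rfl | hie
        · rwa [Function.update_self]
        · rw [Function.update_of_ne hie]
          exact h1 i ⟨hie, hi⟩
    rw [this, Measure.prod_prod, Measure.infinitePi_pi _ (fun i _ => ht i), mul_comm,
      Finset.mul_prod_erase s (fun i => μ i (t i)) he]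
  · have : (fun q : (∀ i, X i) × X e => Function.update q.1 e q.2) ⁻¹' (s : Set ι).pi t =
        (s : Set ι).pi t ×ˢ univ := by
      ext q
      simp only [mem_preimage, Set.mem_pi, Finset.mem_coe, mem_prod, mem_univ, and_true]
      refine forall₂_congr fun i hi => ?_
      rw [Function.update_of_ne (ne_of_mem_of_not_mem hi he)]
    rw [this, Measure.prod_prod, Measure.infinitePi_pi _ (fun i _ => ht i), measure_univ, mul_one]

theorem measurableSet_isPDistanceMatrix (p : ℝ) :
    MeasurableSet {r : ℕ → ℕ → ℝ | IsPDistanceMatrix p r} := by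
  have hm : ∀ i j : ℕ, Measurable fun r : ℕ → ℕ → ℝ => r i j := fun i j =>
    (measurable_pi_apply j).comp (measurable_pi_apply i)
  have : {r : ℕ → ℕ → ℝ | IsPDistanceMatrix p r} =
      (⋂ i, {r | r i i = 0}) ∩ (⋂ i, ⋂ j, {r | 0 ≤ r i j}) ∩ (⋂ i, ⋂ j, {r | r i j = r j i}) ∩
        ⋂ i, ⋂ j, ⋂ k, {r | r i j ^ p ≤ r i k ^ p + r k j ^ p} := by
    ext r
    simp only [mem_inter_iff, mem_iInter]
    exact ⟨fun h => ⟨⟨⟨h.1, h.2⟩, h.3⟩, h.4⟩, fun h => ⟨h.1.1.1, h.1.1.2, h.1.2, h.2⟩⟩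
  rw [this]
  refine (((MeasurableSet.iInter fun i => ?_).inter (MeasurableSet.iInter fun i =>
    MeasurableSet.iInter fun j => ?_)).inter (MeasurableSet.iInter fun i =>
    MeasurableSet.iInter fun j => ?_)).inter (MeasurableSet.iInter fun i =>
    MeasurableSet.iInter fun j => MeasurableSet.iInter fun k => ?_)
  · exact measurableSet_eq_fun (hm i i) measurable_const
  · exact measurableSet_le measurable_const (hm i j)
  · exact measurableSet_eq_fun (hm i j) (hm j i)
  · exact measurableSet_le ((hm i j).pow_const p) (((hm i k).pow_const p).add ((hm k j).pow_const p))

theorem exists_isRandomPMetricLaw {p : ℝ} (hp : 0 < p) (γ : Measure ℝ≥0)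
    [IsProbabilityMeasure γ] : ∃ ν, IsRandomPMetricLaw p γ ν := by
  let μ : ℕ × ℕ → Measure ℝ := fun e => inputLaw γ e.1
  have hR := measurable_inputMatrix p
  refine ⟨(Measure.infinitePi μ).map (inputMatrix p),
    Measure.isProbabilityMeasure_map hR.aemeasurable, ?_, ?_⟩
  · rw [ae_map_iff hR.aemeasurable (measurableSet_isPDistanceMatrix p)]
    have hin : ∀ᵐ ω ∂Measure.infinitePi μ, ∀ e, ω e ∈ inputRange e.1 := by
      rw [ae_all_iff]
      intro e
      have h1 := measurePreserving_eval_infinitePi μ e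
      exact h1.quasiMeasurePreserving.ae (p := fun t => t ∈ inputRange e.1)
        (inputLaw_compl_inputRange γ e.1)
    filter_upwards [hin] with ω hω
    refine isPDistanceMatrix_of_fillEntry hp (inputMatrix_self p ω) (inputMatrix_symm p ω)
      fun k n hkn => ⟨ω (k, n), hω (k, n), (inputMatrix_eq_fillEntry p ω hkn).symm⟩
  · intro n k hkn B hB C hC
    have hB' : MeasurableSet B := fragmentAlgebra_le _ _ _ hB
    have hfill : Measurable fun q : (ℕ → ℕ → ℝ) × ℝ => fillEntry p q.1 (fun i => q.1 i n) k q.2 :=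
      (measurable_fillEntry p k).comp
        (f := fun q : (ℕ → ℕ → ℝ) × ℝ => ((q.1, fun i => q.1 i n), q.2))
        ((measurable_fst.prodMk (measurable_pi_lambda _ fun i => (measurable_pi_apply n).comp
          ((measurable_pi_apply i).comp measurable_fst))).prodMk measurable_snd)
    have hlaw : Measurable fun r => nextEntryLaw p γ r n k C := by
      simp only [nextEntryLaw_apply p γ _ n k hC]
      exact measurable_measure_prodMk_left (hfill hC)
    have hBC : MeasurableSet (B ∩ {r : ℕ → ℕ → ℝ | r k n ∈ C}) :=
      hB'.inter (((measurable_pi_apply n).comp (measurable_pi_apply k)) hC)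
    have hu : Measurable fun q : (ℕ × ℕ → ℝ) × ℝ => Function.update q.1 (k, n) q.2 :=
      measurable_update'
    -- On the left the input at `(k, n)` is resampled. The fresh input does not affect membership in
    -- `B`, and it enters the entry through `fillEntry`, so integrating over it alone gives the
    -- prescribed law.
    rw [Measure.map_apply hR hBC, setLIntegral_map hB' hlaw hR, ← map_update_infinitePi μ (k, n),
      Measure.map_apply hu (hR hBC), Measure.prod_apply (hu (hR hBC)),
      map_update_infinitePi μ (k, n), ← lintegral_indicator (hR hB')]
    refine lintegral_congr fun ω => ?_
    have hmem : ∀ t, Function.update ω (k, n) t ∈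
        inputMatrix p ⁻¹' (B ∩ {r : ℕ → ℕ → ℝ | r k n ∈ C}) ↔ inputMatrix p ω ∈ B ∧
          fillEntry p (inputMatrix p ω) (fun i => inputMatrix p ω i n) k t ∈ C := by
      intro t
      have hag := inputMatrix_update_agree p ω hkn t
      refine and_congr (mem_iff_of_agreeOnFragment hB hag) ?_
      change inputMatrix p (Function.update ω (k, n) t) k n ∈ C ↔ _
      rw [inputMatrix_eq_fillEntry p _ hkn, Function.update_self,
        fillEntry_congr p t (fun i hi => hag i k (Or.inl (by omega)))
          (fun i hi => hag i n (Or.inr (by omega)))]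
    by_cases hω : inputMatrix p ω ∈ B
    · rw [indicator_of_mem (mem_preimage.2 hω), nextEntryLaw_apply p γ _ n k hC]
      congr 1
      ext t
      exact (hmem t).trans (and_iff_right hω)
    · rw [indicator_of_notMem (by exact hω)]
      convert measure_empty (μ := μ (k, n))
      ext t
      exact iff_of_false (fun h => hω ((hmem t).1 h).1) (notMem_empty t)

/-- The law of the absolute value of a standard Gaussian. Some such `γ` is needed to obtain a first
universal matrix from the random construction. -/
theorem exists_diffuse_measure_full_support :
    ∃ γ : Measure ℝ≥0, IsProbabilityMeasure γ ∧ NullSingletonClass γ ∧ γ.IsOpenPosMeasure := by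
  let g := ProbabilityTheory.gaussianReal 0 1
  have hc : Continuous Real.nnabs := continuous_abs.subtype_mk _
  have hm : Measurable Real.nnabs := hc.measurable
  have : NullSingletonClass g := ProbabilityTheory.nullSingletonClass_gaussianReal one_ne_zero
  refine ⟨g.map Real.nnabs, Measure.isProbabilityMeasure_map hm.aemeasurable, ⟨fun x => ?_⟩,
    ⟨fun O hO hne => ?_⟩⟩
  · rw [Measure.map_apply hm (measurableSet_singleton x)]
    refine measure_mono_null (t := {(x : ℝ), -(x : ℝ)}) (fun t ht => ?_)
      (Set.Finite.measure_zero (by simp) g)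
    have h1 : |t| = x := by
      rw [← Real.coe_nnabs, mem_singleton_iff.1 ht]
    rcases abs_choice t with h | h
    · left; rw [← h1, h]
    · right; rw [← h1, h, neg_neg]; rfl
  · rw [Measure.map_apply hm hO.measurableSet]
    intro h0
    have h1 : volume (Real.nnabs ⁻¹' O) = 0 :=
      ProbabilityTheory.gaussianReal_absolutelyContinuous' 0 one_ne_zero h0
    refine (hO.preimage hc).measure_ne_zero volume ?_ h1
    obtain ⟨x, hx⟩ := hne
    exact ⟨x, by simpa using hx⟩

theorem mainTheorem9 :
    (∀ (p : ℝ) (hp : 1 ≤ p),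
      ∃ (U : Type) (_ : MetricSpace U) (_ : CompleteSpace U) (_ : SeparableSpace U),
        IsPMetricSpace p U ∧
        EmbedsPolishPMetricSpaces.{u} p U ∧
        IsFinitelyHomogeneous U ∧
        (∀ (V : Type v) [MetricSpace V] [CompleteSpace V] [SeparableSpace V],
          IsPMetricSpace p V → EmbedsPolishPMetricSpaces.{u} p V → IsFinitelyHomogeneous V →
            Nonempty (V ≃ᵢ U)) ∧
        (∀ (γ : Measure ℝ≥0) [IsProbabilityMeasure γ] [NullSingletonClass γ] [γ.IsOpenPosMeasure],
          (∃ ν : Measure (ℕ → ℕ → ℝ), IsRandomPMetricLaw p γ ν) ∧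
          ∀ ν : Measure (ℕ → ℕ → ℝ), IsRandomPMetricLaw p γ ν →
            ∀ᵐ r ∂ν, ∃ hr : IsPDistanceMatrix p r,
              IsProperMatrix r ∧ IsUniversalPDistanceMatrix p r ∧
                Nonempty (MatrixCompletion hp hr ≃ᵢ U))) ∧
    ¬ ∃ (U : Type v) (_ : MetricSpace U) (_ : CompleteSpace U) (_ : SeparableSpace U),
        IsUltrametricDist U ∧
        ∀ (X : Type u) [MetricSpace X] [CompleteSpace X] [SeparableSpace X]
          [IsUltrametricDist X], ∃ f : X → U, Isometry f := by
  refine ⟨fun p hp => ?_, not_exists_universal_ultrametric⟩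
  have hp0 : 0 < p := by linarith
  obtain ⟨r, hr⟩ : ∃ r, IsUniversalPDistanceMatrix p r := by
    obtain ⟨γ, _, _, _⟩ := exists_diffuse_measure_full_support
    obtain ⟨ν, hν⟩ := exists_isRandomPMetricLaw hp0 γ
    have := hν.isProbabilityMeasure
    exact (hν.ae_isUniversal hp0).exists
  have hU := MatrixCompletion.isPMetricSpace hp hr.1
  have hU' := MatrixCompletion.finiteExtension hp hr.1 hr
  have hsep := MatrixCompletion.separableSpace hp hr.1
  refine ⟨MatrixCompletion hp hr.1, inferInstance, inferInstance, hsep, hU, ?_, ?_, ?_, ?_⟩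
  · intro X _ _ _ hX
    exact FiniteExtension.exists_isometry hX hU'
  · intro n a b hab
    exact FiniteExtension.exists_isometryEquiv hU hU' hU hU' a b hab
  · intro V _ _ _ hV hV1 hV2
    -- Back-and-forth started from the empty partial isometry.
    obtain ⟨J, -⟩ := FiniteExtension.exists_isometryEquiv hV (hV2.finiteExtension hp hV1) hU hU'
      Fin.elim0 Fin.elim0 fun i => i.elim0
    exact ⟨J⟩
  · intro γ _ _ _
    refine ⟨exists_isRandomPMetricLaw hp0 γ, fun ν hν => ?_⟩
    filter_upwards [hν.ae_isUniversal hp0, hν.ae_isProperMatrix hp] with s hs hs'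
    refine ⟨hs.1, hs', hs, ?_⟩
    have := MatrixCompletion.separableSpace hp hs.1
    obtain ⟨J, -⟩ := FiniteExtension.exists_isometryEquiv
      (MatrixCompletion.isPMetricSpace hp hs.1) (MatrixCompletion.finiteExtension hp hs.1 hs)
      hU hU' Fin.elim0 Fin.elim0 fun i => i.elim0
    exact ⟨J⟩
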